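/- Let $\mathcal V_0\subset\mathbb R^2$ be bounded with interior $\mathcal V$, and let $f:\mathcal V_0\to\mathbb R^2$ be continuous on $\mathcal V_0$ and $C^4$ on $\mathcal V$. Suppose that on $\mathcal V$ the Jacobian $f'$ has real eigenvalues $\lambda_1<\lambda_2$ with right eigenvectors $r_1,r_2$ and $\lambda_i'\cdot r_i\neq 0$ ($i=1,2$); that there are a strictly convex $\eta\in C(\mathcal V_0)\cap C^3(\mathcal V)$ and $q\in C(\mathcal V_0)\cap C^3(\mathcal V)$ with $q'=\eta' f'$ on $\mathcal V$; that for every $b\in\mathcal V$ and every left eigenvector $\ell$ of $f'(b)$ the function $\ell\cdot f$ is convex or concave on $\mathcal V$; and that $|\lambda_i|\le L$ on $\mathcal V$ for some $L>0$. For $a\in\mathcal V_0$, $b\in\mathcal V$ put $$\eta(a|b)=\eta(a)-\eta(b)-\nabla\eta(b)(a-b),\qquad q(a;b)=q(a)-q(b)-\nabla\eta(b)(f(a)-f(b)).$$ A rarefaction wave is a function $\bar u:[v_L,v_R]\to\mathcal V$, $v_L\le v_R$, such that for one $i\in\{1,2\}$ and all $y\in[v_L,v_R]$: $\lambda_i(\bar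 u(y))=y$ and $\bar u$ is differentiable at $y$ (one-sidedly at the end points), $\bar u'(y)$ being a right eigenvector of $f'(\bar u(y))$ for $\lambda_i(\bar u(y))$. Write $u_L=\bar u(v_L)$, $u_R=\bar u(v_R)$ and $$\delta=|v_L-v_R|+\sup_{y\in[v_L,v_R]}|u_L-\bar u(y)|.$$ Let $\mathcal S_{weak}$ be the set of $u\in L^\infty((0,\infty)\times\mathbb R)$ with values a.e. in $\mathcal V_0$ and $f(u),\eta(u),q(u)$ essentially bounded (automatic if $\mathcal V_0$ is closed), such that: - for some measurable $u^0:\mathbb R\to\mathcal V_0$ with $\eta(u^0)\in L^\infty(\mathbb R)$ and all $\phi\in C_c^\infty([0,\infty)\times\mathbb R)$, $$\int_0^\infty\!\!\int_{\mathbb R}\big(\phi_t u+\phi_x f(u)\big)\,dx\,dt+\int_{\mathbb R}\phi(0,x)u^0(x)\,dx=0,$$ and, if moreover $\phi\ge0$, $$\int_0^\infty\!\!\int_{\mathbb R}\big(\phi_t\,\eta(u)+\phi_x\, q(u)\big)\,dx\,dt+\int_{\mathbb R}\phi(0,x)\eta(u^0(x))\,dx\ge0;$$ - for every Lipschitz curve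 $X$ there are strong traces $u_\pm\in L^\infty(0,\infty)$ of $u$ along $X$: for all $T>0$, $$\lim_{n\to\infty}\int_0^T\operatorname*{ess\,sup}_{y\in(0,1/n)}|u(t,X(t)+y)-u_+(t)|\,dt=\lim_{n\to\infty}\int_0^T\operatorname*{ess\,sup}_{y\in(-1/n,0)}|u(t,X(t)+y)-u_-(t)|\,dt=0 .$$ Write $u(t,X(t)\pm)=u_\pm(t)$. **Proposition.** For every compact set $K\subset\mathcal V$ there is a constant $C>0$ (depending only on the system and on $K$) such that for every rarefaction wave $\bar u$ with values in $K$, every $u\in\mathcal S_{weak}$, every $v\in[v_L,v_R]$ such that the traces of $u$ along $x=vs$ have values in $\mathcal V_0$ for a.e. $s>0$ (automatic if $\mathcal V_0$ is closed), and every $t>0$, the integrand below is integrable on $(0,t)$ and $$\int_0^t\Big\{q(u(s,sv+);u_R)-q(u(s,sv-);u_L)-v\big(\eta(u(s,sv+)|u_R)-\eta(u(s,sv-)|u_L)\big)\Big\}\,ds\le C\,\delta\,|u_L-u_R|\,t .$$ -/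

import Mathlib

open Set MeasureTheory Filter Topology
open scoped ContDiff

/-- The plane `ℝ²` of states, with the Euclidean norm. -/
abbrev StatePlane : Type := EuclideanSpace ℝ (Fin 2)

/-- The system `u_t + f(u)_x = 0` with set of states `V₀` (whose interior is the set `V` of regular
states), entropy `η`, entropy flux `q`, eigenvalues `lam 0 < lam 1` of `f'` on `V` and associated
right eigenvectors `r 0`, `r 1`: strictly hyperbolic, genuinely nonlinear, endowed with a strictly
convex entropy, with the convexity property of `ℓ · f` for left eigenvectors `ℓ`, and with bounded
characteristic speeds. (Convexity of `V₀` is part of `StrictConvexOn ℝ V₀ η`.) -/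
structure IsAdmissibleSystem (V₀ : Set StatePlane) (f : StatePlane → StatePlane)
    (η q : StatePlane → ℝ) (lam : Fin 2 → StatePlane → ℝ)
    (r : Fin 2 → StatePlane → StatePlane) : Prop where
  bounded : Bornology.IsBounded V₀
  flux_cont : ContinuousOn f V₀
  flux_smooth : ContDiffOn ℝ 4 f (interior V₀)
  eigenvector_ne_zero : ∀ u ∈ interior V₀, ∀ i, r i u ≠ 0
  eigen : ∀ u ∈ interior V₀, ∀ i, fderiv ℝ f u (r i u) = lam i u • r i u
  strictly_hyperbolic : ∀ u ∈ interior V₀, lam 0 u < lam 1 u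
  genuinely_nonlinear : ∀ u ∈ interior V₀, ∀ i, fderiv ℝ (lam i) u (r i u) ≠ 0
  entropy_convex : StrictConvexOn ℝ V₀ η
  entropy_cont : ContinuousOn η V₀
  entropy_smooth : ContDiffOn ℝ 3 η (interior V₀)
  entropyFlux_cont : ContinuousOn q V₀
  entropyFlux_smooth : ContDiffOn ℝ 3 q (interior V₀)
  entropy_compat : ∀ u ∈ interior V₀, fderiv ℝ q u = (fderiv ℝ η u).comp (fderiv ℝ f u)
  left_eigenvector_convex : ∀ b ∈ interior V₀, ∀ (ℓ : StatePlane →L[ℝ] ℝ) (μ : ℝ), ℓ ≠ 0 →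
    ℓ.comp (fderiv ℝ f b) = μ • ℓ →
    ConvexOn ℝ (interior V₀) (fun u => ℓ (f u)) ∨ ConcaveOn ℝ (interior V₀) (fun u => ℓ (f u))
  bounded_speed : ∃ L > 0, ∀ u ∈ interior V₀, ∀ i, |lam i u| ≤ L

/-- The relative entropy `η(a|b) = η(a) - η(b) - ∇η(b)(a - b)`. -/
noncomputable def relEntropy (η : StatePlane → ℝ) (a b : StatePlane) : ℝ :=
  η a - η b - fderiv ℝ η b (a - b)

/-- The relative entropy flux `q(a;b) = q(a) - q(b) - ∇η(b)(f(a) - f(b))`. -/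
noncomputable def relEntropyFlux (f : StatePlane → StatePlane) (η q : StatePlane → ℝ)
    (a b : StatePlane) : ℝ :=
  q a - q b - fderiv ℝ η b (f a - f b)

/-- Lebesgue measure on the open half plane `{(t, x) : t > 0}`. -/
noncomputable def halfPlaneMeasure : Measure (ℝ × ℝ) :=
  volume.restrict (Ioi (0 : ℝ) ×ˢ univ)

/-- `u₋` and `u₊` are the left and right strong traces of `u` along the curve `x = X t`, `t > 0`.
The suprema are essential ones, since `u` is an element of `L^∞`. -/
structure HasStrongTraces (u : ℝ × ℝ → StatePlane) (X : ℝ → ℝ) (uminus uplus : ℝ → StatePlane) :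
    Prop where
  meas_minus : AEStronglyMeasurable uminus (volume.restrict (Ioi 0))
  meas_plus : AEStronglyMeasurable uplus (volume.restrict (Ioi 0))
  bounded_minus : ∃ M : ℝ, ∀ᵐ t ∂(volume.restrict (Ioi (0 : ℝ))), ‖uminus t‖ ≤ M
  bounded_plus : ∃ M : ℝ, ∀ᵐ t ∂(volume.restrict (Ioi (0 : ℝ))), ‖uplus t‖ ≤ M
  lim_plus : ∀ T : ℝ, 0 < T → Tendsto (fun n : ℕ => ∫⁻ t in Ioc 0 T,
    essSup (fun y => ‖u (t, X t + y) - uplus t‖ₑ) (volume.restrict (Ioo (0 : ℝ) (1 / n))))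
    atTop (𝓝 0)
  lim_minus : ∀ T : ℝ, 0 < T → Tendsto (fun n : ℕ => ∫⁻ t in Ioc 0 T,
    essSup (fun y => ‖u (t, X t + y) - uminus t‖ₑ) (volume.restrict (Ioo (-(1 / n) : ℝ) 0)))
    atTop (𝓝 0)

/-- The class of wild solutions: `u ∈ L^∞(ℝ⁺ × ℝ : V₀)` which, for some initial value
`u⁰ ∈ L^∞(ℝ : V₀)`, is a weak solution of `u_t + f(u)_x = 0` and of `η(u)_t + q(u)_x ≤ 0`, and which
has strong traces along every Lipschitz curve. Test functions on `[0,∞) × ℝ` are restrictions of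
smooth compactly supported functions on the plane. The fields `nonlinear_bounded` and the bound on
`η(u⁰)` say that the nonlinear quantities in the weak formulations are bounded too; they follow from
the other ones when `V₀` is closed. -/
structure IsWildSolution (V₀ : Set StatePlane) (f : StatePlane → StatePlane)
    (η q : StatePlane → ℝ) (u : ℝ × ℝ → StatePlane) : Prop where
  meas : AEStronglyMeasurable u halfPlaneMeasure
  mem : ∀ᵐ p ∂halfPlaneMeasure, u p ∈ V₀
  nonlinear_bounded : ∃ M : ℝ, ∀ᵐ p ∂halfPlaneMeasure,
    ‖f (u p)‖ ≤ M ∧ |η (u p)| ≤ M ∧ |q (u p)| ≤ M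
  weak : ∃ u0 : ℝ → StatePlane, AEStronglyMeasurable u0 volume ∧ (∀ᵐ x, u0 x ∈ V₀) ∧
    (∃ M : ℝ, ∀ᵐ x, |η (u0 x)| ≤ M) ∧
    (∀ φ : ℝ × ℝ → ℝ, ContDiff ℝ ∞ φ → HasCompactSupport φ →
      (∫ p, (fderiv ℝ φ p (1, 0) • u p + fderiv ℝ φ p (0, 1) • f (u p)) ∂halfPlaneMeasure)
        + ∫ x, φ (0, x) • u0 x = 0) ∧
    (∀ φ : ℝ × ℝ → ℝ, ContDiff ℝ ∞ φ → HasCompactSupport φ → (∀ t x, 0 ≤ t → 0 ≤ φ (t, x)) →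
      0 ≤ (∫ p, (fderiv ℝ φ p (1, 0) * η (u p) + fderiv ℝ φ p (0, 1) * q (u p)) ∂halfPlaneMeasure)
        + ∫ x, φ (0, x) * η (u0 x))
  traces : ∀ X : ℝ → ℝ, (∃ k, LipschitzWith k X) → ∃ uminus uplus, HasStrongTraces u X uminus uplus

/-- `ubar`, on `[vL, vR]`, is the profile of a (centered) rarefaction wave `(t, x) ↦ ubar (x / t)`
of one of the two families: it has values in the interior of `V₀`, the characteristic speed of the
state `ubar y` is `y`, and `ubar' y` is a right eigenvector of `f' (ubar y)` for that speed. -/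
def IsRarefactionWave (V₀ : Set StatePlane) (f : StatePlane → StatePlane)
    (lam : Fin 2 → StatePlane → ℝ) (vL vR : ℝ) (ubar : ℝ → StatePlane) : Prop :=
  vL ≤ vR ∧ ∃ i : Fin 2, ∀ y ∈ Icc vL vR, ubar y ∈ interior V₀ ∧ lam i (ubar y) = y ∧
    ∃ w : StatePlane, w ≠ 0 ∧ HasDerivWithinAt ubar w (Icc vL vR) y ∧
      fderiv ℝ f (ubar y) w = lam i (ubar y) • w

/-- `δ = |vL - vR| + sup_{y ∈ [vL, vR]} |ubar vL - ubar y|`. -/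
noncomputable def rarefactionSize (vL vR : ℝ) (ubar : ℝ → StatePlane) : ℝ :=
  |vL - vR| + sSup ((fun y => ‖ubar vL - ubar y‖) '' Icc vL vR)

/-! For a state b put G_b(a) = q(a;b) - v η(a|b). The integrand is G_{u_R}(u_+) - G_{u_L}(u_-),
which splits as [G_{u_R}(u_+) - G_{u_R}(u_-)] + [G_{u_R}(u_-) - G_{u_L}(u_-)].

The first bracket has nonpositive time integral. Up to an affine function of the state, η(·|u_R) is
η, so by the conservation law it is again dissipated (`IsWildSolution.isWeakSupersolution`). Testing
the inequality with bumps concentrating on x = vt leaves only the jump of the flux minus v times the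
jump of the entropy (`IsWeakSupersolution.integral_jump_nonneg`). The strong traces make the limits
at the line meaningful (`ae_essTendstoAlong_of_trace`).

The second bracket is bounded pointwise, for every state a
(`IsAdmissibleSystem.exists_relative_sub_le`). Along the rarefaction, d/dy G_{ū(y)}(a) = -(ℓ(f(a) -
f(ū)) - v ℓ(a - ū)) with ℓ = η''(ū) ū'. Since η'' symmetrizes f', ℓ is zero or a left eigenvector
with eigenvalue y. As λ_i grows along the wave, ℓ·f must be convex when ℓ ≠ 0, whence ℓ(f(a) - f(ū))
≥ y ℓ(a - ū) (`IsAdmissibleSystem.lam_mul_hessian_le`). The derivative is therefore at most (v - y)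
ℓ(a - ū) = O(v_R - v_L), and integration gives O((v_R - v_L)²). One factor is at most δ; the other
is O(|u_L - u_R|) because λ_i is Lipschitz on K. -/

/-! ### Convex functions and nonnegative bilinear forms. -/

section ConvexCalculus

variable {E : Type*} [NormedAddCommGroup E] [NormedSpace ℝ E]

/-- The gradient inequality for convex functions. -/
theorem ConvexOn.hasFDerivAt_apply_sub_le {g : E → ℝ} {s : Set E} (hg : ConvexOn ℝ s g)
    {x y : E} (hx : x ∈ s) (hy : y ∈ s) {L : E →L[ℝ] ℝ} (hL : HasFDerivAt g L x) :
    L (y - x) ≤ g y - g x := by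
  have hc := hg.comp_affineMap (AffineMap.lineMap x y : ℝ →ᵃ[ℝ] E)
  have hd : HasDerivAt (g ∘ (AffineMap.lineMap x y : ℝ →ᵃ[ℝ] E)) (L (y - x)) 0 := by
    refine HasFDerivAt.comp_hasDerivAt (0 : ℝ) ?_ AffineMap.hasDerivAt_lineMap
    simpa using hL
  have h := hc.le_slope_of_hasDerivAt (x := 0) (y := 1) (by simpa using hx) (by simpa using hy)
    one_pos hd
  simpa [slope_def_field] using h

/-- The second derivative of a convex function is nonnegative. -/
theorem ConvexOn.fderiv_fderiv_nonneg {g : E → ℝ} {s : Set E} (hs : IsOpen s)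
    (hg : ConvexOn ℝ s g) (hd : ContDiffOn ℝ 2 g s) {x : E} (hx : x ∈ s) (h : E) :
    0 ≤ fderiv ℝ (fderiv ℝ g) x h h := by
  have hdiff : ∀ y ∈ s, DifferentiableAt ℝ g y := fun y hy =>
    (hd.differentiableOn (by norm_num)).differentiableAt (hs.mem_nhds hy)
  have hdiff2 : DifferentiableAt ℝ (fderiv ℝ g) x :=
    ((hd.fderiv_of_isOpen hs (m := 1) (by norm_num)).differentiableOn
      (by norm_num)).differentiableAt (hs.mem_nhds hx)
  have hline : HasDerivAt (fun t : ℝ => x + t • h) h 0 := by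
    simpa using ((hasDerivAt_id (0 : ℝ)).smul_const h).const_add x
  have hder : HasDerivAt (fun t : ℝ => fderiv ℝ g (x + t • h) h)
      (fderiv ℝ (fderiv ℝ g) x h h) 0 := by
    have h1 : HasDerivAt (fun t : ℝ => fderiv ℝ g (x + t • h)) (fderiv ℝ (fderiv ℝ g) x h) 0 :=
      HasFDerivAt.comp_hasDerivAt (0 : ℝ) (by simpa using hdiff2.hasFDerivAt) hline
    exact h1.clm_apply (hasDerivAt_const _ _) |>.congr_deriv (by simp)
  have hslope := hder.tendsto_slope
  have hslope' : Tendsto (slope (fun t : ℝ => fderiv ℝ g (x + t • h) h) 0) (𝓝[>] 0)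
      (𝓝 (fderiv ℝ (fderiv ℝ g) x h h)) :=
    hslope.mono_left (nhdsWithin_mono _ fun t ht => ne_of_gt ht)
  have hin : ∀ᶠ t in 𝓝[>] (0 : ℝ), x + t • h ∈ s := by
    refine nhdsWithin_le_nhds (hline.continuousAt.eventually_mem ?_)
    simpa using hs.mem_nhds hx
  refine ge_of_tendsto hslope' ?_
  filter_upwards [hin, self_mem_nhdsWithin] with t ht ht0
  have ht0 : 0 < t := ht0
  -- Adding the gradient inequalities in both directions gives monotonicity of the gradient, so the
  -- slopes are nonnegative.
  have h1 := hg.hasFDerivAt_apply_sub_le hx ht (hdiff x hx).hasFDerivAt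
  have h2 := hg.hasFDerivAt_apply_sub_le ht hx (hdiff _ ht).hasFDerivAt
  have e1 : x + t • h - x = t • h := by abel
  have e2 : x - (x + t • h) = -(t • h) := by abel
  rw [e1, map_smul, smul_eq_mul] at h1
  rw [e2, map_neg, map_smul, smul_eq_mul] at h2
  rw [slope_def_field]
  simp only [zero_smul, add_zero, sub_zero]
  refine div_nonneg ?_ ht0.le
  have : 0 ≤ t * (fderiv ℝ g (x + t • h) h - fderiv ℝ g x h) := by linarith
  exact nonneg_of_mul_nonneg_right this ht0

/-- The gradient inequality at an interior point, up to the boundary. -/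
theorem ConvexOn.hasFDerivAt_apply_sub_le_of_interior {g : E → ℝ} {s : Set E} (hs : Convex ℝ s)
    (hg : ConvexOn ℝ (interior s) g) (hc : ContinuousOn g s) {a b : E} (ha : a ∈ s)
    (hb : b ∈ interior s) {L : E →L[ℝ] ℝ} (hL : HasFDerivAt g L b) :
    L (a - b) ≤ g a - g b := by
  -- The half-open segment from the interior point b to a stays in the interior, so the inequality
  -- holds there and passes to the limit t → 1.
  have hmem : ∀ t ∈ Ico (0 : ℝ) 1, b + t • (a - b) ∈ interior s := by
    intro t ht
    have h := hs.combo_self_interior_mem_interior ha hb ht.1 (sub_pos.2 ht.2)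
      (by ring : t + (1 - t) = 1)
    convert h using 1
    module
  have hne : (𝓝[<] (1 : ℝ)).NeBot := inferInstance
  have hev : ∀ᶠ t in 𝓝[<] (1 : ℝ), t ∈ Ico (0 : ℝ) 1 := Ico_mem_nhdsLT one_pos
  have hline : Tendsto (fun t : ℝ => b + t • (a - b)) (𝓝[<] 1) (𝓝 a) := by
    have : Continuous fun t : ℝ => b + t • (a - b) := by fun_prop
    have h := (this.tendsto 1).mono_left (nhdsWithin_le_nhds (s := Iio 1))
    simpa using h
  have hline' : Tendsto (fun t : ℝ => b + t • (a - b)) (𝓝[<] 1) (𝓝[s] a) :=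
    tendsto_nhdsWithin_iff.2 ⟨hline, hev.mono fun t ht => interior_subset (hmem t ht)⟩
  have h1 : Tendsto (fun t : ℝ => g (b + t • (a - b)) - g b) (𝓝[<] 1) (𝓝 (g a - g b)) :=
    ((hc a ha).tendsto.comp hline').sub_const _
  have h2 : Tendsto (fun t : ℝ => L (b + t • (a - b) - b)) (𝓝[<] 1) (𝓝 (L (a - b))) :=
    (L.continuous.tendsto _).comp (hline.sub_const b)
  exact le_of_tendsto_of_tendsto h2 h1
    (hev.mono fun t ht => hg.hasFDerivAt_apply_sub_le hb (hmem t ht) hL)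

/-- A nonnegative symmetric bilinear form `B` with `B w w = 0` satisfies `B w = 0`. -/
theorem bilin_eq_zero_of_nonneg {B : E →L[ℝ] E →L[ℝ] ℝ} (hB : ∀ x, 0 ≤ B x x)
    (hsymm : ∀ x y, B x y = B y x) {w : E} (hw : B w w = 0) : B w = 0 := by
  ext x
  by_contra hne
  have hne : B w x ≠ 0 := hne
  -- With B w w = 0 the form is affine in the coefficient of w; this coefficient is chosen large
  -- enough to make the value negative if B w x ≠ 0.
  have h := hB ((-(B x x + 1)) • w + (B w x) • x)
  have e : B ((-(B x x + 1)) • w + (B w x) • x) ((-(B x x + 1)) • w + (B w x) • x)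
      = -(B x x + 2) * (B w x) ^ 2 := by
    simp only [map_add, map_smul, _root_.add_apply, _root_.smul_apply,
      smul_eq_mul, hw, hsymm x w]
    ring
  rw [e] at h
  have : 0 < (B w x) ^ 2 := by positivity
  nlinarith [hB x]

end ConvexCalculus

/-! ### Trace, determinant and eigenvectors in the plane. -/

section PlaneAlgebra

/-- The trace of an endomorphism of the plane. -/
noncomputable def planeTrace (A : StatePlane →L[ℝ] StatePlane) : ℝ :=
  A (EuclideanSpace.single 0 1) 0 + A (EuclideanSpace.single 1 1) 1

/-- The determinant of an endomorphism of the plane. -/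
noncomputable def planeDet (A : StatePlane →L[ℝ] StatePlane) : ℝ :=
  A (EuclideanSpace.single 0 1) 0 * A (EuclideanSpace.single 1 1) 1
    - A (EuclideanSpace.single 0 1) 1 * A (EuclideanSpace.single 1 1) 0

theorem StatePlane.apply_eq (A : StatePlane →L[ℝ] StatePlane) (x : StatePlane) (i : Fin 2) :
    A x i = x 0 * A (EuclideanSpace.single 0 1) i + x 1 * A (EuclideanSpace.single 1 1) i := by
  have hx : x = x 0 • EuclideanSpace.single 0 (1 : ℝ) + x 1 • EuclideanSpace.single 1 (1 : ℝ) := by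
    ext j; fin_cases j <;> simp
  conv_lhs => rw [hx]
  simp

/-- Cayley–Hamilton in the plane. -/
theorem planeCayleyHamilton (A : StatePlane →L[ℝ] StatePlane) (x : StatePlane) :
    A (A x) = planeTrace A • A x - planeDet A • x := by
  ext i
  simp only [PiLp.sub_apply, PiLp.smul_apply, smul_eq_mul]
  rw [StatePlane.apply_eq A (A x) i, StatePlane.apply_eq A x 0, StatePlane.apply_eq A x 1,
    StatePlane.apply_eq A x i]
  fin_cases i <;> simp only [planeTrace, planeDet, Fin.zero_eta, Fin.mk_one] <;> ring

theorem planeCharpoly_eq_zero {A : StatePlane →L[ℝ] StatePlane} {x : StatePlane} {μ : ℝ}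
    (hx : x ≠ 0) (h : A x = μ • x) : μ ^ 2 - planeTrace A * μ + planeDet A = 0 := by
  have h1 := planeCayleyHamilton A x
  rw [h, map_smul, h] at h1
  have h2 : (μ ^ 2 - planeTrace A * μ + planeDet A) • x = 0 := by
    have : (μ ^ 2 - planeTrace A * μ + planeDet A) • x
        = μ • μ • x - (planeTrace A • μ • x - planeDet A • x) := by module
    rw [this, h1, sub_self]
  exact (smul_eq_zero.1 h2).resolve_right hx

theorem planeTrace_planeDet_eq {A : StatePlane →L[ℝ] StatePlane} {x y : StatePlane} {μ ν : ℝ}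
    (hx : x ≠ 0) (hy : y ≠ 0) (h : A x = μ • x) (h' : A y = ν • y) (hne : μ ≠ ν) :
    planeTrace A = μ + ν ∧ planeDet A = μ * ν := by
  have h1 := planeCharpoly_eq_zero hx h
  have h2 := planeCharpoly_eq_zero hy h'
  have h3 : (μ - ν) * (μ + ν - planeTrace A) = 0 := by linear_combination h1 - h2
  have h4 := (mul_eq_zero.1 h3).resolve_left (sub_ne_zero.2 hne)
  have h5 : planeTrace A = μ + ν := by linarith
  refine ⟨h5, ?_⟩
  rw [h5] at h1
  linarith

/-- Distinct eigenvalues: an eigenvector for `μ` is a multiple of any other one. -/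
theorem exists_smul_eq_of_eigenvector {A : StatePlane →L[ℝ] StatePlane} {x y w : StatePlane}
    {μ ν : ℝ} (hx : x ≠ 0) (hy : y ≠ 0) (h : A x = μ • x) (h' : A y = ν • y) (hne : μ ≠ ν)
    (hw : A w = μ • w) : ∃ c : ℝ, w = c • x := by
  have hli : LinearIndependent ℝ ![x, y] := by
    rw [LinearIndependent.pair_iff]
    intro s t hst
    have h1 : s • μ • x + t • ν • y = 0 := by
      rw [← h, ← h', ← map_smul, ← map_smul, ← map_add, hst, map_zero]
    have h2 : (s * (μ - ν)) • x = 0 := by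
      have : (s * (μ - ν)) • x = (s • μ • x + t • ν • y) - ν • (s • x + t • y) := by module
      rw [this, h1, hst, smul_zero, sub_zero]
    have h3 : s = 0 := by
      have := (smul_eq_zero.1 h2).resolve_right hx
      exact (mul_eq_zero.1 this).resolve_right (sub_ne_zero.2 hne)
    refine ⟨h3, ?_⟩
    rw [h3, zero_smul, zero_add] at hst
    exact (smul_eq_zero.1 hst).resolve_right hy
  have htop := hli.span_eq_top_of_card_eq_finrank' (by simp)
  have hmem : w ∈ Submodule.span ℝ (Set.range ![x, y]) := by rw [htop]; trivial
  rw [Matrix.range_cons_cons_empty, Submodule.mem_span_pair] at hmem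
  obtain ⟨s, t, rfl⟩ := hmem
  refine ⟨s, ?_⟩
  rw [map_add, map_smul, map_smul, h, h'] at hw
  have h2 : (t * (ν - μ)) • y = 0 := by
    have : (t * (ν - μ)) • y = (s • μ • x + t • ν • y) - μ • (s • x + t • y) := by module
    rw [this, hw, sub_self]
  have h3 : t = 0 := by
    have := (smul_eq_zero.1 h2).resolve_right hy
    exact (mul_eq_zero.1 this).resolve_right (sub_ne_zero.2 hne.symm)
  simp [h3]

end PlaneAlgebra

/-! ### Regularity of the eigenvalues and differential identities of the system. -/

namespace IsAdmissibleSystem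

variable {V₀ : Set StatePlane} {f : StatePlane → StatePlane} {η q : StatePlane → ℝ}
  {lam : Fin 2 → StatePlane → ℝ} {r : Fin 2 → StatePlane → StatePlane}

/-- In `Fin 2`, `1 - i` is the index of the other family. -/
theorem lam_ne (h : IsAdmissibleSystem V₀ f η q lam r) {u : StatePlane} (hu : u ∈ interior V₀)
    (i : Fin 2) : lam i u ≠ lam (1 - i) u := by
  have := h.strictly_hyperbolic u hu
  fin_cases i
  · exact this.ne
  · exact this.ne'

theorem contDiffOn_fderiv_flux (h : IsAdmissibleSystem V₀ f η q lam r) :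
    ContDiffOn ℝ 2 (fderiv ℝ f) (interior V₀) :=
  h.flux_smooth.fderiv_of_isOpen isOpen_interior (by norm_num)

theorem trace_det_eq (h : IsAdmissibleSystem V₀ f η q lam r) {u : StatePlane}
    (hu : u ∈ interior V₀) : planeTrace (fderiv ℝ f u) = lam 0 u + lam 1 u ∧
      planeDet (fderiv ℝ f u) = lam 0 u * lam 1 u :=
  planeTrace_planeDet_eq (h.eigenvector_ne_zero u hu 0) (h.eigenvector_ne_zero u hu 1)
    (h.eigen u hu 0) (h.eigen u hu 1) (h.strictly_hyperbolic u hu).ne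

/-- The eigenvalues are `C²` functions of the state. -/
theorem contDiffOn_lam (h : IsAdmissibleSystem V₀ f η q lam r) (i : Fin 2) :
    ContDiffOn ℝ 2 (lam i) (interior V₀) := by
  have hentry : ∀ (e : StatePlane) (j : Fin 2),
      ContDiffOn ℝ 2 (fun u => fderiv ℝ f u e j) (interior V₀) := fun e j =>
    ((EuclideanSpace.proj j : StatePlane →L[ℝ] ℝ).contDiff.comp_contDiffOn
      (h.contDiffOn_fderiv_flux.clm_apply contDiffOn_const))
  have htr : ContDiffOn ℝ 2 (fun u => planeTrace (fderiv ℝ f u)) (interior V₀) :=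
    (hentry _ _).add (hentry _ _)
  have hdet : ContDiffOn ℝ 2 (fun u => planeDet (fderiv ℝ f u)) (interior V₀) :=
    ((hentry _ _).mul (hentry _ _)).sub ((hentry _ _).mul (hentry _ _))
  have hdisc : ∀ u ∈ interior V₀, planeTrace (fderiv ℝ f u) ^ 2 - 4 * planeDet (fderiv ℝ f u)
      = (lam 1 u - lam 0 u) ^ 2 := by
    intro u hu
    rw [(h.trace_det_eq hu).1, (h.trace_det_eq hu).2]
    ring
  -- The eigenvalues come from the quadratic formula; strict hyperbolicity keeps the discriminant
  -- away from the singularity of the square root.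
  have hsqrt : ContDiffOn ℝ 2 (fun u => Real.sqrt (planeTrace (fderiv ℝ f u) ^ 2
      - 4 * planeDet (fderiv ℝ f u))) (interior V₀) := by
    refine ((htr.pow 2).sub (contDiffOn_const.mul hdet)).sqrt fun u hu => ?_
    rw [hdisc u hu]
    exact pow_ne_zero 2 (sub_ne_zero.2 (h.strictly_hyperbolic u hu).ne')
  have hval : ∀ u ∈ interior V₀, Real.sqrt (planeTrace (fderiv ℝ f u) ^ 2
      - 4 * planeDet (fderiv ℝ f u)) = lam 1 u - lam 0 u := fun u hu => by
    rw [hdisc u hu, Real.sqrt_sq (sub_nonneg.2 (h.strictly_hyperbolic u hu).le)]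
  fin_cases i
  · refine ((htr.sub hsqrt).mul (contDiffOn_const (c := (1 / 2 : ℝ)))).congr fun u hu => ?_
    change lam 0 u = (planeTrace (fderiv ℝ f u) - Real.sqrt (planeTrace (fderiv ℝ f u) ^ 2
      - 4 * planeDet (fderiv ℝ f u))) * (1 / 2)
    rw [hval u hu, (h.trace_det_eq hu).1]
    ring
  · refine ((htr.add hsqrt).mul (contDiffOn_const (c := (1 / 2 : ℝ)))).congr fun u hu => ?_
    change lam 1 u = (planeTrace (fderiv ℝ f u) + Real.sqrt (planeTrace (fderiv ℝ f u) ^ 2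
      - 4 * planeDet (fderiv ℝ f u))) * (1 / 2)
    rw [hval u hu, (h.trace_det_eq hu).1]
    ring

theorem differentiableAt_lam (h : IsAdmissibleSystem V₀ f η q lam r) (i : Fin 2) {u : StatePlane}
    (hu : u ∈ interior V₀) : DifferentiableAt ℝ (lam i) u :=
  ((h.contDiffOn_lam i).differentiableOn (by norm_num)).differentiableAt
    (isOpen_interior.mem_nhds hu)

theorem continuousOn_fderiv_lam (h : IsAdmissibleSystem V₀ f η q lam r) (i : Fin 2) :
    ContinuousOn (fderiv ℝ (lam i)) (interior V₀) :=
  (h.contDiffOn_lam i).continuousOn_fderiv_of_isOpen isOpen_interior (by norm_num)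

theorem convex_states (h : IsAdmissibleSystem V₀ f η q lam r) : Convex ℝ V₀ :=
  h.entropy_convex.1

theorem hasFDerivAt_flux (h : IsAdmissibleSystem V₀ f η q lam r) {u : StatePlane}
    (hu : u ∈ interior V₀) : HasFDerivAt f (fderiv ℝ f u) u :=
  ((h.flux_smooth.differentiableOn (by norm_num)).differentiableAt
    (isOpen_interior.mem_nhds hu)).hasFDerivAt

theorem hasFDerivAt_fderiv_flux (h : IsAdmissibleSystem V₀ f η q lam r) {u : StatePlane}
    (hu : u ∈ interior V₀) : HasFDerivAt (fderiv ℝ f) (fderiv ℝ (fderiv ℝ f) u) u :=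
  ((h.contDiffOn_fderiv_flux.differentiableOn (by norm_num)).differentiableAt
    (isOpen_interior.mem_nhds hu)).hasFDerivAt

theorem contDiffOn_fderiv_entropy (h : IsAdmissibleSystem V₀ f η q lam r) :
    ContDiffOn ℝ 2 (fderiv ℝ η) (interior V₀) :=
  h.entropy_smooth.fderiv_of_isOpen isOpen_interior (by norm_num)

theorem hasFDerivAt_fderiv_entropy (h : IsAdmissibleSystem V₀ f η q lam r) {u : StatePlane}
    (hu : u ∈ interior V₀) : HasFDerivAt (fderiv ℝ η) (fderiv ℝ (fderiv ℝ η) u) u :=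
  ((h.contDiffOn_fderiv_entropy.differentiableOn (by norm_num)).differentiableAt
    (isOpen_interior.mem_nhds hu)).hasFDerivAt

theorem hasFDerivAt_entropy (h : IsAdmissibleSystem V₀ f η q lam r) {u : StatePlane}
    (hu : u ∈ interior V₀) : HasFDerivAt η (fderiv ℝ η u) u :=
  ((h.entropy_smooth.differentiableOn (by norm_num)).differentiableAt
    (isOpen_interior.mem_nhds hu)).hasFDerivAt

theorem hasFDerivAt_entropyFlux (h : IsAdmissibleSystem V₀ f η q lam r) {u : StatePlane}
    (hu : u ∈ interior V₀) : HasFDerivAt q ((fderiv ℝ η u).comp (fderiv ℝ f u)) u := by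
  rw [← h.entropy_compat u hu]
  exact ((h.entropyFlux_smooth.differentiableOn (by norm_num)).differentiableAt
    (isOpen_interior.mem_nhds hu)).hasFDerivAt

theorem hessian_symm (h : IsAdmissibleSystem V₀ f η q lam r) {u : StatePlane}
    (hu : u ∈ interior V₀) (x y : StatePlane) :
    fderiv ℝ (fderiv ℝ η) u x y = fderiv ℝ (fderiv ℝ η) u y x :=
  (h.entropy_smooth.contDiffAt (isOpen_interior.mem_nhds hu)).isSymmSndFDerivAt (by norm_num) x y

theorem hessian_nonneg (h : IsAdmissibleSystem V₀ f η q lam r) {u : StatePlane}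
    (hu : u ∈ interior V₀) (x : StatePlane) : 0 ≤ fderiv ℝ (fderiv ℝ η) u x x :=
  (h.entropy_convex.convexOn.subset interior_subset
    h.convex_states.interior).fderiv_fderiv_nonneg isOpen_interior
    (h.entropy_smooth.of_le (by norm_num)) hu x

/-- The Hessian of the entropy symmetrizes the Jacobian of the flux. -/
theorem hessian_flux_symm (h : IsAdmissibleSystem V₀ f η q lam r) {u : StatePlane}
    (hu : u ∈ interior V₀) (x y : StatePlane) :
    fderiv ℝ (fderiv ℝ η) u x (fderiv ℝ f u y) = fderiv ℝ (fderiv ℝ η) u (fderiv ℝ f u x) y := by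
  -- Differentiating q' = η' f' gives q''(x,y) = η''(x, f' y) + η'(f''(x,y)). Both q'' and f'' are
  -- symmetric, hence so is the remaining term.
  have hq : HasFDerivAt (fderiv ℝ q) _ u :=
    ((h.hasFDerivAt_fderiv_entropy hu).clm_comp (h.hasFDerivAt_fderiv_flux hu)).congr_of_eventuallyEq
      (Filter.mem_of_superset (isOpen_interior.mem_nhds hu) fun y hy => h.entropy_compat y hy)
  have hqs := (h.entropyFlux_smooth.contDiffAt
    (isOpen_interior.mem_nhds hu)).isSymmSndFDerivAt (by norm_num) x y
  have hfs := (h.flux_smooth.contDiffAt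
    (isOpen_interior.mem_nhds hu)).isSymmSndFDerivAt (by norm_num) x y
  rw [hq.fderiv] at hqs
  simp at hqs
  rw [hfs] at hqs
  rw [h.hessian_symm hu (fderiv ℝ f u x) y]
  linarith

/-- The derivative of the eigenvalue in the direction of its eigenvector. -/
theorem left_eigen_second_fderiv (h : IsAdmissibleSystem V₀ f η q lam r) {u : StatePlane}
    (hu : u ∈ interior V₀) {i : Fin 2} {w : StatePlane} (hw : fderiv ℝ f u w = lam i u • w)
    {ℓ : StatePlane →L[ℝ] ℝ} (hℓ : ∀ y, ℓ (fderiv ℝ f u y) = lam i u * ℓ y) :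
    ℓ (fderiv ℝ (fderiv ℝ f) u w w) = fderiv ℝ (lam i) u w * ℓ w := by
  set j := 1 - i with hj
  -- Cayley–Hamilton is applied to the fixed vector w at varying states, so no eigenvector field has
  -- to be differentiated.
  have hCH : ∀ y ∈ interior V₀, fderiv ℝ f y (fderiv ℝ f y w)
      - (lam i y + lam j y) • fderiv ℝ f y w + (lam i y * lam j y) • w = 0 := by
    intro y hy
    have h1 := planeCayleyHamilton (fderiv ℝ f y) w
    rw [(h.trace_det_eq hy).1, (h.trace_det_eq hy).2] at h1
    rw [h1, hj]
    fin_cases i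
    · simp
    · simp [add_comm (lam 0 y), mul_comm (lam 0 y)]
  have hA := h.hasFDerivAt_fderiv_flux hu
  have hAw := hA.clm_apply (hasFDerivAt_const w u)
  have hi := (h.differentiableAt_lam i hu).hasFDerivAt
  have hjd := (h.differentiableAt_lam j hu).hasFDerivAt
  have hD := (((hA.clm_apply hAw).sub ((hi.add hjd).smul hAw)).add
    ((hi.mul hjd).smul (hasFDerivAt_const w u)))
  have hz : HasFDerivAt (fun y => fderiv ℝ f y (fderiv ℝ f y w)
      - (lam i y + lam j y) • fderiv ℝ f y w + (lam i y * lam j y) • w)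
      (0 : StatePlane →L[ℝ] StatePlane) u :=
    (hasFDerivAt_const (0 : StatePlane) u).congr_of_eventuallyEq
      (Filter.mem_of_superset (isOpen_interior.mem_nhds hu) fun y hy => hCH y hy)
  -- Differentiated along w and paired with ℓ, the identity reduces to (λ_i - λ_j)(ℓ f''(w,w) -
  -- (λ_i' w) ℓ w) = 0.
  have heq := congrArg (fun T : StatePlane →L[ℝ] StatePlane => ℓ (T w)) (hD.unique hz)
  simp [hw, hℓ] at heq
  have hne := sub_ne_zero.2 (h.lam_ne hu i)
  apply mul_left_cancel₀ hne
  linear_combination heq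

end IsAdmissibleSystem

/-! ### Variation of the relative quantities along a rarefaction. -/

namespace IsAdmissibleSystem

variable {V₀ : Set StatePlane} {f : StatePlane → StatePlane} {η q : StatePlane → ℝ}
  {lam : Fin 2 → StatePlane → ℝ} {r : Fin 2 → StatePlane → StatePlane}

/-- The convexity inequality for `ℓ · f`, where `ℓ = ∇²η w` and the right eigenvector `w` points
in the direction of increasing characteristic speed. -/
theorem lam_mul_hessian_le (h : IsAdmissibleSystem V₀ f η q lam r) {u : StatePlane}
    (hu : u ∈ interior V₀) {i : Fin 2} {w : StatePlane} (hw : fderiv ℝ f u w = lam i u • w)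
    (hpos : 0 < fderiv ℝ (lam i) u w) {a : StatePlane} (ha : a ∈ V₀) :
    lam i u * fderiv ℝ (fderiv ℝ η) u w (a - u) ≤ fderiv ℝ (fderiv ℝ η) u w (f a - f u) := by
  set ℓ := fderiv ℝ (fderiv ℝ η) u w with hℓdef
  have hℓ : ∀ y, ℓ (fderiv ℝ f u y) = lam i u * ℓ y := fun y => by
    rw [hℓdef, h.hessian_flux_symm hu, hw]
    simp
  -- Strict convexity of η allows a degenerate Hessian, so ℓ may vanish; the inequality is then
  -- trivial.
  by_cases h0 : ℓ = 0
  · simp [h0]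
  have hcomp : ℓ.comp (fderiv ℝ f u) = lam i u • ℓ := by
    ext y
    simpa using hℓ y
  have hd : ∀ y ∈ interior V₀, HasFDerivAt (fun y => ℓ (f y)) (ℓ.comp (fderiv ℝ f y)) y :=
    fun y hy => ℓ.hasFDerivAt.comp y (h.hasFDerivAt_flux hy)
  rcases h.left_eigenvector_convex u hu ℓ (lam i u) h0 hcomp with hc | hc
  · have := hc.hasFDerivAt_apply_sub_le_of_interior h.convex_states
      (ℓ.continuous.comp_continuousOn h.flux_cont) ha hu (hd u hu)
    rw [map_sub ℓ (f a), ← hℓ]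
    exact this
  -- Concavity would force ℓ f''(w,w) ≤ 0, but this number is (λ_i' w) ℓ w > 0: the nonnegative form
  -- η'' vanishes at (w,w) only if ℓ = 0.
  · exfalso
    have hww : 0 < ℓ w := by
      refine lt_of_le_of_ne (h.hessian_nonneg hu w) fun hz => h0 ?_
      exact bilin_eq_zero_of_nonneg (h.hessian_nonneg hu) (h.hessian_symm hu) hz.symm
    have h2 : HasFDerivAt (fderiv ℝ (-fun y => ℓ (f y))) _ u :=
      ((((hasFDerivAt_const ℓ u).clm_comp (h.hasFDerivAt_fderiv_flux hu)).neg).congr_of_eventuallyEq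
        (Filter.mem_of_superset (isOpen_interior.mem_nhds hu) fun y hy => (hd y hy).neg.fderiv))
    have h3 := (neg_convexOn_iff.2 hc).fderiv_fderiv_nonneg isOpen_interior
      ((ℓ.contDiff.comp_contDiffOn (h.flux_smooth.of_le (by norm_num))).neg) hu w
    rw [h2.fderiv] at h3
    have h4 := h.left_eigen_second_fderiv hu hw hℓ
    simp at h3
    have : 0 < fderiv ℝ (lam i) u w * ℓ w := mul_pos hpos hww
    linarith

/-- The derivative of the relative quantities in the second variable, along a curve. -/
theorem hasDerivWithinAt_relative (h : IsAdmissibleSystem V₀ f η q lam r) (a : StatePlane) (v : ℝ)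
    {c : ℝ → StatePlane} {w : StatePlane} {s : Set ℝ} {y : ℝ} (hc : c y ∈ interior V₀)
    (hw : HasDerivWithinAt c w s y) :
    HasDerivWithinAt (fun y => relEntropyFlux f η q a (c y) - v * relEntropy η a (c y))
      (-(fderiv ℝ (fderiv ℝ η) (c y) w (f a - f (c y))
        - v * fderiv ℝ (fderiv ℝ η) (c y) w (a - c y))) s y := by
  have hq := (h.hasFDerivAt_entropyFlux hc).comp_hasDerivWithinAt y hw
  have hη := (h.hasFDerivAt_entropy hc).comp_hasDerivWithinAt y hw
  have hf := (h.hasFDerivAt_flux hc).comp_hasDerivWithinAt y hw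
  have hη' := (h.hasFDerivAt_fderiv_entropy hc).comp_hasDerivWithinAt y hw
  -- By q' = η' f', the first-order terms coming from q and from f cancel; only those with η''
  -- survive.
  have h1 := (hq.const_sub (q a)).sub (hη'.clm_apply (hf.const_sub (f a)))
  have h2 := (hη.const_sub (η a)).sub (hη'.clm_apply (hw.const_sub a))
  refine (h1.sub (h2.const_mul v)).congr_deriv ?_
  simp
  ring

/-- Right eigenvectors are transversal to the level sets of the eigenvalue, uniformly on compact
sets. -/
theorem exists_le_abs_fderiv_lam (h : IsAdmissibleSystem V₀ f η q lam r) {K : Set StatePlane}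
    (hK : IsCompact K) (hKV : K ⊆ interior V₀) (i : Fin 2) :
    ∃ c > 0, ∀ u ∈ K, ∀ w, fderiv ℝ f u w = lam i u • w → c * ‖w‖ ≤ |fderiv ℝ (lam i) u w| := by
  set S : Set (StatePlane × StatePlane) := K ×ˢ Metric.sphere (0 : StatePlane) 1
  have hS : IsCompact S := hK.prod (isCompact_sphere _ _)
  have hfst : MapsTo (Prod.fst : StatePlane × StatePlane → StatePlane) S (interior V₀) :=
    fun p hp => hKV hp.1
  -- The second summand penalizes unit vectors that are not eigenvectors. Thus F is continuous and
  -- positive on a compact set, and no continuity of r is needed.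
  set F : StatePlane × StatePlane → ℝ := fun p =>
    |fderiv ℝ (lam i) p.1 p.2| + ‖fderiv ℝ f p.1 p.2 - lam i p.1 • p.2‖
  have hF : ContinuousOn F S := by
    have h1 : ContinuousOn (fun p : StatePlane × StatePlane => fderiv ℝ (lam i) p.1) S :=
      (h.continuousOn_fderiv_lam i).comp continuousOn_fst hfst
    have h2 : ContinuousOn (fun p : StatePlane × StatePlane => fderiv ℝ f p.1) S :=
      h.contDiffOn_fderiv_flux.continuousOn.comp continuousOn_fst hfst
    have h3 : ContinuousOn (fun p : StatePlane × StatePlane => lam i p.1) S :=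
      (h.contDiffOn_lam i).continuousOn.comp continuousOn_fst hfst
    exact (h1.clm_apply continuousOn_snd).abs.add
      ((h2.clm_apply continuousOn_snd).sub (h3.smul continuousOn_snd)).norm
  have hpos : ∀ p ∈ S, 0 < F p := by
    intro p hp
    have hp1 := hKV hp.1
    have hp2 : p.2 ≠ 0 := fun h0 => by
      have : ‖p.2‖ = 1 := by simpa using hp.2
      simp [h0] at this
    by_cases he : fderiv ℝ f p.1 p.2 = lam i p.1 • p.2
    · obtain ⟨c, hc⟩ := exists_smul_eq_of_eigenvector (h.eigenvector_ne_zero _ hp1 i)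
        (h.eigenvector_ne_zero _ hp1 (1 - i)) (h.eigen _ hp1 i) (h.eigen _ hp1 (1 - i))
        (h.lam_ne hp1 i) he
      have hc0 : c ≠ 0 := fun h0 => hp2 (by rw [hc, h0, zero_smul])
      have : fderiv ℝ (lam i) p.1 p.2 ≠ 0 := by
        rw [hc, map_smul, smul_eq_mul]
        exact mul_ne_zero hc0 (h.genuinely_nonlinear _ hp1 i)
      exact add_pos_of_pos_of_nonneg (abs_pos.2 this) (norm_nonneg _)
    · exact add_pos_of_nonneg_of_pos (abs_nonneg _) (norm_pos_iff.2 (sub_ne_zero.2 he))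
  obtain ⟨c, hc, hcF⟩ := hS.exists_forall_le' hF hpos
  refine ⟨c, hc, fun u hu w hw => ?_⟩
  rcases eq_or_ne w 0 with rfl | hw0
  · simp
  have hn : 0 < ‖w‖ := norm_pos_iff.2 hw0
  have h1 := hcF (u, ‖w‖⁻¹ • w) ⟨hu, by simp [norm_smul, hn.ne']⟩
  have h2 : fderiv ℝ f u (‖w‖⁻¹ • w) - lam i u • (‖w‖⁻¹ • w) = 0 := by
    rw [map_smul, hw, smul_comm, sub_self]
  simp only [F, h2, norm_zero, add_zero] at h1
  simp only [map_smul, smul_eq_mul, abs_mul, abs_inv, abs_norm] at h1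
  rwa [inv_mul_eq_div, le_div_iff₀ hn] at h1

/-- The eigenvalues are Lipschitz on compact sets of regular states. -/
theorem exists_lam_sub_le (h : IsAdmissibleSystem V₀ f η q lam r) {K : Set StatePlane}
    (hK : IsCompact K) (hKV : K ⊆ interior V₀) (i : Fin 2) :
    ∃ M, 0 ≤ M ∧ ∀ a ∈ K, ∀ b ∈ K, lam i b - lam i a ≤ M * ‖a - b‖ := by
  -- K need not be convex: P is the union of all segments between its points, compact and still
  -- inside the convex interior of `V₀`.
  set P : Set StatePlane :=
    (fun p : (StatePlane × StatePlane) × ℝ => AffineMap.lineMap p.1.1 p.1.2 p.2) ''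
      ((K ×ˢ K) ×ˢ Icc (0 : ℝ) 1) with hP
  have hPc : IsCompact P := by
    refine ((hK.prod hK).prod isCompact_Icc).image ?_
    simp only [AffineMap.lineMap_apply_module]
    fun_prop
  have hseg : ∀ a ∈ K, ∀ b ∈ K, segment ℝ a b ⊆ P := by
    intro a ha b hb
    rw [segment_eq_image_lineMap]
    rintro _ ⟨t, ht, rfl⟩
    exact ⟨((a, b), t), ⟨⟨ha, hb⟩, ht⟩, rfl⟩
  have hsub : P ⊆ interior V₀ := by
    rintro _ ⟨⟨⟨a, b⟩, t⟩, ⟨⟨ha, hb⟩, ht⟩, rfl⟩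
    exact h.convex_states.interior.lineMap_mem (hKV ha) (hKV hb) ht
  obtain ⟨M, hM⟩ := hPc.exists_bound_of_continuousOn
    ((h.continuousOn_fderiv_lam i).mono hsub)
  refine ⟨max M 0, le_max_right _ _, fun a ha b hb => ?_⟩
  have := (convex_segment a b).norm_image_sub_le_of_norm_fderiv_le
    (fun x hx => h.differentiableAt_lam i (hsub (hseg a ha b hb hx)))
    (fun x hx => (hM x (hseg a ha b hb hx)).trans (le_max_left M 0))
    (left_mem_segment ℝ a b) (right_mem_segment ℝ a b)
  rw [norm_sub_rev b a] at this
  exact (le_abs_self _).trans this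

/-- Replacing the right end state of a rarefaction by the left one in the relative quantities costs
at most the strength of the rarefaction times the variation of the speed. -/
theorem exists_relative_sub_le (h : IsAdmissibleSystem V₀ f η q lam r) {K : Set StatePlane}
    (hK : IsCompact K) (hKV : K ⊆ interior V₀) :
    ∃ C : ℝ, 0 < C ∧ ∀ (vL vR : ℝ) (ubar : ℝ → StatePlane),
      IsRarefactionWave V₀ f lam vL vR ubar → (∀ y ∈ Icc vL vR, ubar y ∈ K) →
      ∀ v ∈ Icc vL vR, ∀ a ∈ V₀,
        (relEntropyFlux f η q a (ubar vR) - v * relEntropy η a (ubar vR))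
          - (relEntropyFlux f η q a (ubar vL) - v * relEntropy η a (ubar vL))
          ≤ C * (vR - vL) * ‖ubar vL - ubar vR‖ := by
  choose c hc hcK using h.exists_le_abs_fderiv_lam hK hKV
  choose M hM hMK using h.exists_lam_sub_le hK hKV
  obtain ⟨D, hD⟩ := h.bounded.exists_norm_le
  obtain ⟨B, hB⟩ := hK.exists_bound_of_continuousOn
    ((h.contDiffOn_fderiv_entropy.continuousOn_fderiv_of_isOpen isOpen_interior
      (by norm_num)).mono hKV)
  set A : Fin 2 → ℝ := fun i => |B| * (c i)⁻¹ * (2 * |D|) * M i with hA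
  have hA0 : ∀ i, 0 ≤ A i := fun i => by
    have := hc i
    have := hM i
    positivity
  -- The sum covers both families, and the 1 makes the constant positive.
  refine ⟨A 0 + A 1 + 1, by linarith [hA0 0, hA0 1], ?_⟩
  rintro vL vR ubar ⟨hle, i, hwave⟩ hval v hv a ha
  have hAi : A i ≤ A 0 + A 1 + 1 := by
    fin_cases i
    · simpa using by linarith [hA0 1]
    · simpa using by linarith [hA0 0]
  -- On a one-point interval derivatives within it are not unique, so the constant wave is treated
  -- apart.
  rcases hle.eq_or_lt with rfl | hlt
  · simp
  have hL : vL ∈ Icc vL vR := left_mem_Icc.2 hle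
  have hR : vR ∈ Icc vL vR := right_mem_Icc.2 hle
  have hspeed : vR - vL ≤ M i * ‖ubar vL - ubar vR‖ := by
    have := hMK i _ (hval vL hL) _ (hval vR hR)
    rwa [(hwave vL hL).2.1, (hwave vR hR).2.1] at this
  set g : ℝ → ℝ := fun y => relEntropyFlux f η q a (ubar y) - v * relEntropy η a (ubar y) with hg
  have key : ∀ y ∈ Icc vL vR, ∃ d, HasDerivWithinAt g d (Icc vL vR) y ∧
      d ≤ (vR - vL) * (|B| * (c i)⁻¹ * (2 * |D|)) := by
    intro y hy
    obtain ⟨hyV, hlam, w, -, hder, hw⟩ := hwave y hy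
    refine ⟨_, h.hasDerivWithinAt_relative a v hyV hder, ?_⟩
    -- Differentiating λ_i(ū(y)) = y fixes the orientation of ū' and, through genuine nonlinearity,
    -- bounds its length.
    have hone : fderiv ℝ (lam i) (ubar y) w = 1 := by
      have h1 := (h.differentiableAt_lam i hyV).hasFDerivAt.comp_hasDerivWithinAt y hder
      have h2 : HasDerivWithinAt (lam i ∘ ubar) 1 (Icc vL vR) y :=
        (hasDerivWithinAt_id y _).congr (fun z hz => (hwave z hz).2.1) hlam
      exact (uniqueDiffOn_Icc hlt y hy).eq_deriv _ h1 h2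
    have hwn : ‖w‖ ≤ (c i)⁻¹ := by
      have := hcK i _ (hval y hy) w hw
      rw [hone, abs_one] at this
      rw [← one_div, le_div_iff₀ (hc i), mul_comm]
      exact this
    have hkey := h.lam_mul_hessian_le hyV hw (by rw [hone]; exact one_pos) ha
    rw [hlam] at hkey
    set ℓ := fderiv ℝ (fderiv ℝ η) (ubar y) w
    have hℓ : |ℓ (a - ubar y)| ≤ |B| * (c i)⁻¹ * (2 * |D|) := by
      have h1 : ‖ℓ‖ ≤ |B| * (c i)⁻¹ :=
        (ContinuousLinearMap.le_opNorm _ _).trans (mul_le_mul ((hB _ (hval y hy)).trans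
          (le_abs_self B)) hwn (norm_nonneg _) (abs_nonneg _))
      have h2 : ‖a - ubar y‖ ≤ 2 * |D| := by
        have h3 := hD a ha
        have h4 := hD _ (interior_subset hyV)
        have := norm_sub_le a (ubar y)
        linarith [le_abs_self D]
      exact (ℓ.le_opNorm _).trans (mul_le_mul h1 h2 (norm_nonneg _) (by have := hc i; positivity))
    have habs : |v - y| ≤ vR - vL := by
      rw [abs_le]
      constructor <;> linarith [hv.1, hv.2, hy.1, hy.2]
    -- Convexity replaces the flux difference by y ℓ(a - ū), leaving the small factor v - y.
    calc -(ℓ (f a - f (ubar y)) - v * ℓ (a - ubar y)) ≤ (v - y) * ℓ (a - ubar y) := by linarith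
      _ ≤ |v - y| * |ℓ (a - ubar y)| := by rw [← abs_mul]; exact le_abs_self _
      _ ≤ _ := mul_le_mul habs hℓ (abs_nonneg _) (by linarith)
  choose! g' hg' hg'le using key
  have hmv := (convex_Icc vL vR).image_sub_le_mul_sub_of_deriv_le
    (fun y hy => (hg' y hy).continuousWithinAt)
    (fun y hy => ((hg' y (interior_subset hy)).mono interior_subset).differentiableWithinAt)
    (C := (vR - vL) * (|B| * (c i)⁻¹ * (2 * |D|))) (fun y hy => by
      rw [((hg' y (interior_subset hy)).hasDerivAt (mem_interior_iff_mem_nhds.1 hy)).deriv]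
      exact hg'le y (interior_subset hy)) vL hL vR hR hle
  have hpos : 0 ≤ |B| * (c i)⁻¹ * (2 * |D|) * (vR - vL) := by
    have := hc i
    have := sub_nonneg.2 hle
    positivity
  calc g vR - g vL ≤ (vR - vL) * (|B| * (c i)⁻¹ * (2 * |D|)) * (vR - vL) := hmv
    _ = (|B| * (c i)⁻¹ * (2 * |D|) * (vR - vL)) * (vR - vL) := by ring
    _ ≤ (|B| * (c i)⁻¹ * (2 * |D|) * (vR - vL)) * (M i * ‖ubar vL - ubar vR‖) :=
      mul_le_mul_of_nonneg_left hspeed hpos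
    _ = A i * ((vR - vL) * ‖ubar vL - ubar vR‖) := by simp only [hA]; ring
    _ ≤ (A 0 + A 1 + 1) * ((vR - vL) * ‖ubar vL - ubar vR‖) :=
      mul_le_mul_of_nonneg_right hAi (mul_nonneg (sub_nonneg.2 hle) (norm_nonneg _))
    _ = _ := by ring

end IsAdmissibleSystem

/-! ### Measurability of compositions and essential suprema; almost everywhere limits. -/

section MeasurableComposition

/-- The composition of a measurable function with values a.e. in `s` and a function continuous
on `s`. -/
theorem ContinuousOn.comp_aestronglyMeasurable_of_ae_mem {α E F : Type*} [MeasurableSpace α]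
    {μ : Measure α} [TopologicalSpace E] [MeasurableSpace E] [BorelSpace E]
    [TopologicalSpace.PseudoMetrizableSpace E]
    [TopologicalSpace F] [TopologicalSpace.PseudoMetrizableSpace F] [SecondCountableTopology F]
    {g : E → F} {s : Set E} (hg : ContinuousOn g s) {u : α → E}
    (hu : AEStronglyMeasurable u μ) (hs : ∀ᵐ x ∂μ, u x ∈ s) :
    AEStronglyMeasurable (fun x => g (u x)) μ := by
  borelize F
  rcases s.eq_empty_or_nonempty with rfl | hne
  · have : μ = 0 := by simpa using hs
    rw [this]
    exact aestronglyMeasurable_zero_measure _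
  -- Nothing is known about g off s, so u is first changed on a null set to take all its values in
  -- s.
  obtain ⟨w, hw, hws, huw⟩ := hu.aemeasurable.exists_ae_eq_range_subset hs hne
  have hws' : ∀ x, w x ∈ s := fun x => hws (mem_range_self x)
  have h1 : Measurable (codRestrict w s hws') := hw.codRestrict hws'
  have h2 : Measurable (fun x => g (w x)) :=
    (continuousOn_iff_continuous_domRestrict.1 hg).measurable.comp h1
  exact ⟨_, h2.stronglyMeasurable, huw.mono fun x hx => by simp only [hx]⟩

/-- The essential supremum of the sections of a measurable function is measurable. -/
theorem Measurable.essSup_prodMk_left {α β : Type*} [MeasurableSpace α] [MeasurableSpace β]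
    {ν : Measure β} [SFinite ν] {g : α × β → ENNReal} (hg : Measurable g) :
    Measurable fun x => essSup (fun y => g (x, y)) ν := by
  refine measurable_of_Ioi fun c => ?_
  -- The essential supremum exceeds c exactly when the section of this superlevel set has positive
  -- measure.
  have h1 : MeasurableSet {p : α × β | c < g p} := measurableSet_lt measurable_const hg
  have h2 := measurable_measure_prodMk_left (ν := ν) h1
  convert h2 (measurableSet_singleton 0).compl using 1
  ext x
  simp only [mem_preimage, mem_Ioi, mem_compl_iff, mem_singleton_iff]
  rw [← not_iff_not, not_lt, not_not]
  have h3 : ν (Prod.mk x ⁻¹' {p : α × β | c < g p}) = 0 ↔ ∀ᵐ y ∂ν, g (x, y) ≤ c := by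
    rw [ae_iff]
    simp only [not_le]
    rfl
  rw [h3]
  constructor
  · intro h
    filter_upwards [ENNReal.ae_le_essSup fun y => g (x, y)] with y hy
    exact hy.trans h
  · exact fun h => essSup_le_of_ae_le c h

theorem AEMeasurable.essSup_prodMk_left {α β : Type*} [MeasurableSpace α] [MeasurableSpace β]
    {μ : Measure α} {ν : Measure β} [SFinite ν] {g : α × β → ENNReal}
    (hg : AEMeasurable g (μ.prod ν)) :
    AEMeasurable (fun x => essSup (fun y => g (x, y)) ν) μ := by
  refine ⟨_, hg.measurable_mk.essSup_prodMk_left (ν := ν), ?_⟩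
  filter_upwards [Measure.ae_ae_of_ae_prod hg.ae_eq_mk] with x hx
  exact essSup_congr_ae hx

/-- An eventually antitone sequence that tends to `0` in `L¹` tends to `0` a.e. -/
theorem ae_tendsto_zero_of_antitone_of_lintegral {α : Type*} [MeasurableSpace α] {μ : Measure α}
    {g : ℕ → α → ENNReal} (hm : ∀ n, AEMeasurable (g n) μ)
    (hanti : ∀ x, Antitone fun n => g (n + 1) x)
    (hlim : Tendsto (fun n => ∫⁻ x, g n x ∂μ) atTop (𝓝 0)) :
    ∀ᵐ x ∂μ, Tendsto (fun n => g n x) atTop (𝓝 0) := by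
  -- The shift to n + 1 matters for the trace intervals: at n = 0 the value 1/0 = 0 makes them
  -- empty, which breaks monotonicity. The infimum has zero integral, hence vanishes a.e.
  have hmi : AEMeasurable (fun x => ⨅ n, g (n + 1) x) μ := AEMeasurable.iInf fun n => hm (n + 1)
  have h0 : ∫⁻ x, ⨅ n, g (n + 1) x ∂μ = 0 := by
    refine le_antisymm (ge_of_tendsto (hlim.comp (tendsto_add_atTop_nat 1)) ?_) bot_le
    exact Eventually.of_forall fun n => lintegral_mono fun x => iInf_le _ n
  rw [lintegral_eq_zero_iff' hmi] at h0
  filter_upwards [h0] with x hx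
  have h1 := tendsto_atTop_iInf (hanti x)
  have h2 : ⨅ n, g (n + 1) x = 0 := hx
  rw [h2] at h1
  exact (tendsto_add_atTop_iff_nat 1).1 h1

end MeasurableComposition

/-! ### One-sided essential limits and concentrating test functions. -/

section EssentialLimits

/-- `p` is the limit of `g` along the shrinking sets `I n`, up to null sets. -/
def EssTendstoAlong (I : ℕ → Set ℝ) (g : ℝ → ℝ) (p : ℝ) : Prop :=
  ∀ ρ > 0, ∀ᶠ n in atTop, ∀ᵐ y ∂(volume.restrict (I n)), |g y - p| ≤ ρ

/-- Strong convergence of U transfers to functions continuous only relative to s, because almost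
every U y lies in s. -/
theorem EssTendstoAlong.of_essSup {I : ℕ → Set ℝ} {U : ℝ → StatePlane} {p : StatePlane}
    (hU : Tendsto (fun n => essSup (fun y => ‖U y - p‖ₑ) (volume.restrict (I n))) atTop (𝓝 0))
    {s : Set StatePlane} (hUs : ∀ᵐ y, U y ∈ s) {h : StatePlane → ℝ}
    (hc : ContinuousWithinAt h s p) : EssTendstoAlong I (fun y => h (U y)) (h p) := by
  intro ρ hρ
  obtain ⟨τ, hτ, hτh⟩ := Metric.continuousWithinAt_iff.1 hc ρ hρ
  filter_upwards [hU.eventually_lt_const (ENNReal.ofReal_pos.2 hτ)] with n hn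
  filter_upwards [ENNReal.ae_le_essSup (μ := volume.restrict (I n)) fun y => ‖U y - p‖ₑ,
    ae_restrict_of_ae hUs] with y hy hys
  have h1 := hy.trans_lt hn
  rw [← ofReal_norm, ENNReal.ofReal_lt_ofReal_iff hτ, ← dist_eq_norm] at h1
  exact (Real.dist_eq _ _ ▸ hτh hys h1).le

theorem EssTendstoAlong.abs_le {I : ℕ → Set ℝ} (hI : ∀ᶠ n in atTop, volume (I n) ≠ 0) {g : ℝ → ℝ}
    {p M : ℝ} (h : EssTendstoAlong I g p) (hM : ∀ᵐ y, |g y| ≤ M) : |p| ≤ M := by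
  refine le_of_forall_pos_le_add fun ρ hρ => ?_
  obtain ⟨n, hn, hIn⟩ := ((h ρ hρ).and hI).exists
  have : (ae (volume.restrict (I n))).NeBot := by
    rw [ae_neBot]
    simpa [Measure.restrict_eq_zero] using hIn
  obtain ⟨y, hy, hyM⟩ := (hn.and (ae_restrict_of_ae hM)).exists
  have := abs_sub_abs_le_abs_sub p (g y)
  rw [abs_sub_comm] at this
  linarith

/-- The sets `(0, 1/n)`. -/
abbrev rightNhd (n : ℕ) : Set ℝ := Ioo (0 : ℝ) (1 / n)

/-- The sets `(-1/n, 0)`. -/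
abbrev leftNhd (n : ℕ) : Set ℝ := Ioo (-(1 / n) : ℝ) 0

theorem volume_rightNhd_ne_zero : ∀ᶠ n in atTop, volume (rightNhd n) ≠ 0 := by
  filter_upwards [eventually_gt_atTop 0] with n hn
  have : (0 : ℝ) < n := by exact_mod_cast hn
  rw [rightNhd, Real.volume_Ioo]
  simpa using hn.ne'

theorem volume_leftNhd_ne_zero : ∀ᶠ n in atTop, volume (leftNhd n) ≠ 0 := by
  filter_upwards [eventually_gt_atTop 0] with n hn
  have : (0 : ℝ) < n := by exact_mod_cast hn
  rw [leftNhd, Real.volume_Ioo]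
  simpa using hn.ne'

/-- Testing against the derivative of a concentrating bump function yields the jump. -/
theorem tendsto_integral_deriv_bump {χ : ℝ → ℝ} (hχ : ContDiff ℝ 1 χ) (hχc : HasCompactSupport χ)
    (hχ0 : χ 0 = 1) (hχ1 : ∀ z, 1 ≤ |z| → deriv χ z = 0) {g : ℝ → ℝ}
    (hg : AEStronglyMeasurable g volume) {M : ℝ} (hM : ∀ᵐ y, |g y| ≤ M) {a b : ℝ}
    (ha : EssTendstoAlong leftNhd g a) (hb : EssTendstoAlong rightNhd g b) :
    Tendsto (fun n : ℕ => ∫ y, n * deriv χ (n * y) * g y) atTop (𝓝 (a - b)) := by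
  have hcont : Continuous (deriv χ) := hχ.continuous_deriv le_rfl
  have hint : Integrable (deriv χ) := hcont.integrable_of_hasCompactSupport hχc.deriv
  -- The step function with the two limits as values is invariant under positive scaling. Its
  -- pairing with the kernel is exactly a - b, since χ' integrates to 1 on the left and to -1 on the
  -- right.
  set g₀ : ℝ → ℝ := fun y => if y ≤ 0 then a else b with hg₀
  have hg₀m : Measurable g₀ := Measurable.ite measurableSet_Iic measurable_const measurable_const
  have hg₀M : ∀ y, ‖g₀ y‖ ≤ max |a| |b| := fun y => by
    simp only [hg₀]
    split_ifs
    · exact le_max_left _ _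
    · exact le_max_right _ _
  have hprod : Integrable (fun z => deriv χ z * g₀ z) :=
    hint.mul_bdd hg₀m.aestronglyMeasurable (Eventually.of_forall hg₀M)
  have hval : ∫ z, deriv χ z * g₀ z = a - b := by
    rw [← intervalIntegral.integral_Iic_add_Ioi (b := 0) hprod.integrableOn hprod.integrableOn]
    have h1 : ∫ z in Iic (0 : ℝ), deriv χ z * g₀ z = ∫ z in Iic (0 : ℝ), deriv χ z * a :=
      setIntegral_congr_fun measurableSet_Iic fun z hz => by
        have hz : z ≤ 0 := hz
        simp [hg₀, hz]
    have h2 : ∫ z in Ioi (0 : ℝ), deriv χ z * g₀ z = ∫ z in Ioi (0 : ℝ), deriv χ z * b :=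
      setIntegral_congr_fun measurableSet_Ioi fun z hz => by
        have hz : ¬ z ≤ 0 := not_le.2 hz
        simp [hg₀, hz]
    rw [h1, h2, integral_mul_const, integral_mul_const, hχc.integral_Iic_deriv_eq hχ,
      hχc.integral_Ioi_deriv_eq hχ, hχ0]
    ring
  set A := ∫ z, |deriv χ z| with hA
  have hA0 : 0 ≤ A := integral_nonneg fun z => abs_nonneg _
  rw [Metric.tendsto_atTop']
  intro ε hε
  have hρ : 0 < ε / (A + 1) := by positivity
  obtain ⟨N, hN⟩ := eventually_atTop.1
    ((ha _ hρ).and ((hb _ hρ).and (eventually_gt_atTop 0)))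
  refine ⟨N, fun n hn => ?_⟩
  obtain ⟨hna, hnb, hn0⟩ := hN n hn.le
  have hnpos : (0 : ℝ) < n := by exact_mod_cast hn0
  have hker : Integrable (fun y : ℝ => n * deriv χ (n * y)) :=
    (hint.comp_mul_left' hnpos.ne').const_mul _
  have habs : ∫ y : ℝ, |n * deriv χ (n * y)| = A := by
    have : ∀ y : ℝ, |n * deriv χ (n * y)| = n * |deriv χ (n * y)| := fun y => by
      rw [abs_mul, abs_of_pos hnpos]
    simp_rw [this]
    rw [integral_const_mul, Measure.integral_comp_mul_left (fun z => |deriv χ z|), abs_inv,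
      abs_of_pos hnpos, smul_eq_mul, mul_inv_cancel_left₀ hnpos.ne']
  have hscale : ∫ y : ℝ, n * deriv χ (n * y) * g₀ y = a - b := by
    have h1 : ∀ y : ℝ, n * deriv χ (n * y) * g₀ y = n * (deriv χ (n * y) * g₀ (n * y)) := by
      intro y
      have : g₀ (n * y) = g₀ y := by
        simp only [hg₀]
        have : (n : ℝ) * y ≤ 0 ↔ y ≤ 0 := by
          rw [mul_nonpos_iff]
          constructor
          · rintro (h | h)
            · exact h.2
            · exact absurd h.1 (not_le.2 hnpos)
          · exact fun h => Or.inl ⟨hnpos.le, h⟩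
        simp only [this]
      rw [this]
      ring
    simp_rw [h1]
    rw [integral_const_mul, Measure.integral_comp_mul_left (fun z => deriv χ z * g₀ z), abs_inv,
      abs_of_pos hnpos, smul_eq_mul, mul_inv_cancel_left₀ hnpos.ne', hval]
  have hi1 : Integrable (fun y : ℝ => n * deriv χ (n * y) * g y) := hker.mul_bdd hg hM
  have hi2 : Integrable (fun y : ℝ => n * deriv χ (n * y) * g₀ y) :=
    hker.mul_bdd hg₀m.aestronglyMeasurable (Eventually.of_forall hg₀M)
  have hbound : ∀ᵐ y : ℝ, ‖n * deriv χ (n * y) * g y - n * deriv χ (n * y) * g₀ y‖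
      ≤ |n * deriv χ (n * y)| * (ε / (A + 1)) := by
    rw [ae_restrict_iff' measurableSet_Ioo] at hna hnb
    filter_upwards [hna, hnb, (measure_eq_zero_iff_ae_notMem.1 (Real.volume_singleton (a := 0)))]
      with y hya hyb hy0
    rw [← mul_sub, Real.norm_eq_abs, abs_mul]
    -- The kernel vanishes for |y| ≥ 1/n; elsewhere y ≠ 0 lies in one of the two intervals, where g
    -- is close to g₀.
    rcases le_or_gt 1 |n * y| with h1 | h1
    · rw [hχ1 _ h1]
      simp
    · refine mul_le_mul_of_nonneg_left ?_ (abs_nonneg _)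
      rw [abs_mul, abs_of_pos hnpos, mul_comm, ← lt_div_iff₀ hnpos, abs_lt] at h1
      rcases lt_trichotomy y 0 with hy | hy | hy
      · simpa [hg₀, hy.le] using hya ⟨h1.1, hy⟩
      · exact absurd hy hy0
      · simpa [hg₀, not_le.2 hy] using hyb ⟨hy, h1.2⟩
  have hfin := norm_integral_le_of_norm_le (hker.abs.mul_const _) hbound
  rw [integral_sub hi1 hi2, hscale, integral_mul_const, habs] at hfin
  rw [dist_eq_norm]
  refine hfin.trans_lt ?_
  rw [← mul_div_assoc, div_lt_iff₀ (by positivity)]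
  nlinarith

end EssentialLimits

/-! ### Jump inequality along a line for weak supersolutions. -/

section HalfPlane

theorem halfPlaneMeasure_eq_prod :
    halfPlaneMeasure = (volume.restrict (Ioi (0 : ℝ))).prod (volume : Measure ℝ) := by
  rw [halfPlaneMeasure, Measure.volume_eq_prod, ← Measure.prod_restrict, Measure.restrict_univ]

/-- The change of variables that straightens the line `x = t v`. -/
theorem measurePreserving_shear (μ : Measure ℝ) [SFinite μ] (v : ℝ) :
    MeasurePreserving (fun p : ℝ × ℝ => (p.1, p.1 * v + p.2)) (μ.prod volume)
      (μ.prod (volume : Measure ℝ)) :=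
  (MeasurePreserving.id μ).skew_product (g := fun t y => t * v + y) (by
    unfold Function.uncurry; fun_prop)
    (Eventually.of_forall fun t => (measurePreserving_add_left volume (t * v)).map_eq)

/-- A bounded function that satisfies a conservation law with production of constant sign:
`(g₁)_t + (g₂)_x ≤ 0` weakly on the open half plane. -/
structure IsWeakSupersolution (g₁ g₂ : ℝ × ℝ → ℝ) : Prop where
  meas₁ : AEStronglyMeasurable g₁ halfPlaneMeasure
  meas₂ : AEStronglyMeasurable g₂ halfPlaneMeasure
  bounded : ∃ M : ℝ, ∀ᵐ p ∂halfPlaneMeasure, |g₁ p| ≤ M ∧ |g₂ p| ≤ M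
  weak : ∀ φ : ℝ × ℝ → ℝ, ContDiff ℝ ∞ φ → HasCompactSupport φ → (∀ p, 0 ≤ φ p) →
    (∀ x, φ (0, x) = 0) →
    0 ≤ ∫ p, (fderiv ℝ φ p (1, 0) * g₁ p + fderiv ℝ φ p (0, 1) * g₂ p) ∂halfPlaneMeasure

variable {g₁ g₂ : ℝ × ℝ → ℝ}

/-- The weak inequality, tested with `ψ(t) χ(k (x - t v))` and written in the coordinates
`(t, x - t v)`. -/
theorem IsWeakSupersolution.sheared_nonneg (h : IsWeakSupersolution g₁ g₂) (v : ℝ) {ψ χ : ℝ → ℝ}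
    (hψ : ContDiff ℝ ∞ ψ) (hψc : HasCompactSupport ψ) (hψ0 : ∀ t, 0 ≤ ψ t) (hψz : ψ 0 = 0)
    (hχ : ContDiff ℝ ∞ χ) (hχ0 : ∀ z, 0 ≤ χ z) (hχ1 : ∀ z, 1 ≤ |z| → χ z = 0)
    {k : ℝ} (hk : 0 < k) :
    0 ≤ ∫ p, (deriv ψ p.1 * χ (k * p.2) * g₁ (p.1, p.1 * v + p.2)
        + ψ p.1 * (k * deriv χ (k * p.2) * (g₂ (p.1, p.1 * v + p.2)
          - v * g₁ (p.1, p.1 * v + p.2))))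
      ∂((volume.restrict (Ioi (0 : ℝ))).prod volume) := by
  set φ : ℝ × ℝ → ℝ := fun p => ψ p.1 * χ (k * (p.2 - p.1 * v)) with hφ
  have hφs : ContDiff ℝ ∞ φ :=
    (hψ.comp contDiff_fst).mul (hχ.comp (by fun_prop))
  have hφc : HasCompactSupport φ := by
    have hK : IsCompact ((fun p : ℝ × ℝ => (p.1, p.1 * v + p.2)) ''
        (tsupport ψ ×ˢ Icc (-(1 / k)) (1 / k))) :=
      (hψc.isCompact.prod isCompact_Icc).image (by fun_prop)
    refine HasCompactSupport.intro hK fun p hp => ?_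
    by_contra hne
    obtain ⟨h1, h2⟩ := mul_ne_zero_iff.1 hne
    have h3 : |k * (p.2 - p.1 * v)| < 1 := by
      by_contra hge
      exact h2 (hχ1 _ (not_lt.1 hge))
    rw [abs_mul, abs_of_pos hk, mul_comm, ← lt_div_iff₀ hk, abs_lt] at h3
    exact hp ⟨(p.1, p.2 - p.1 * v), ⟨subset_tsupport ψ h1, h3.1.le, h3.2.le⟩, by simp⟩
  have hd : ∀ p : ℝ × ℝ, fderiv ℝ φ p (1, 0) * g₁ p + fderiv ℝ φ p (0, 1) * g₂ p
      = deriv ψ p.1 * χ (k * (p.2 - p.1 * v)) * g₁ p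
        + ψ p.1 * (k * deriv χ (k * (p.2 - p.1 * v)) * (g₂ p - v * g₁ p)) := by
    intro p
    have hf1 : HasFDerivAt (fun p : ℝ × ℝ => p.1) (ContinuousLinearMap.fst ℝ ℝ ℝ) p :=
      hasFDerivAt_fst
    have hf2 : HasFDerivAt (fun p : ℝ × ℝ => p.2) (ContinuousLinearMap.snd ℝ ℝ ℝ) p :=
      hasFDerivAt_snd
    have h1 : HasFDerivAt (fun p : ℝ × ℝ => ψ p.1) _ p :=
      ((hψ.differentiable (by simp)) p.1).hasDerivAt.comp_hasFDerivAt p hf1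
    have h2 : HasFDerivAt (fun p : ℝ × ℝ => χ (k * (p.2 - p.1 * v))) _ p :=
      ((hχ.differentiable (by simp)) (k * (p.2 - p.1 * v))).hasDerivAt.comp_hasFDerivAt p
        ((hf2.sub (hf1.mul_const v)).const_mul k)
    have h3 : HasFDerivAt φ _ p := h1.mul h2
    rw [h3.fderiv]
    simp
    ring
  have hw := h.weak φ hφs hφc (fun p => mul_nonneg (hψ0 _) (hχ0 _)) (fun x => by simp [hφ, hψz])
  simp_rw [hd] at hw
  have hmp := measurePreserving_shear (volume.restrict (Ioi (0 : ℝ))) v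
  rw [halfPlaneMeasure_eq_prod, ← hmp.map_eq, integral_map hmp.measurable.aemeasurable] at hw
  · simpa using hw
  · rw [hmp.map_eq, ← halfPlaneMeasure_eq_prod]
    have c1 : Continuous (deriv ψ) := hψ.continuous_deriv (by simp)
    have c2 : Continuous (deriv χ) := hχ.continuous_deriv (by simp)
    have c3 := hψ.continuous
    have c4 := hχ.continuous
    refine (AEStronglyMeasurable.mul ?_ h.meas₁).add
      (AEStronglyMeasurable.mul ?_ (AEStronglyMeasurable.mul ?_ (h.meas₂.sub
        (h.meas₁.const_mul v))))
    all_goals exact Continuous.aestronglyMeasurable (by fun_prop)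

/-- The jump inequality along the line `x = t v`, tested with `ψ`. -/
theorem IsWeakSupersolution.integral_mul_jump_nonneg (h : IsWeakSupersolution g₁ g₂) (v : ℝ)
    {T : ℝ} {a b : ℝ → ℝ}
    (ha : ∀ᵐ t ∂(volume.restrict (Ioc 0 T)),
      EssTendstoAlong leftNhd (fun y => g₂ (t, t * v + y) - v * g₁ (t, t * v + y)) (a t))
    (hb : ∀ᵐ t ∂(volume.restrict (Ioc 0 T)),
      EssTendstoAlong rightNhd (fun y => g₂ (t, t * v + y) - v * g₁ (t, t * v + y)) (b t))
    {ψ : ℝ → ℝ} (hψ : ContDiff ℝ ∞ ψ) (hψc : HasCompactSupport ψ) (hψ0 : ∀ t, 0 ≤ ψ t)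
    (hψT : ∀ t, t ∉ Ioo 0 T → ψ t = 0) :
    0 ≤ ∫ t in Ioc 0 T, ψ t * (a t - b t) := by
  obtain ⟨M₀, hM₀⟩ := h.bounded
  set ν : Measure ℝ := volume.restrict (Ioi (0 : ℝ)) with hν
  have hmp := measurePreserving_shear ν v
  rw [halfPlaneMeasure_eq_prod] at hM₀
  have hm₁ : AEStronglyMeasurable (fun p : ℝ × ℝ => g₁ (p.1, p.1 * v + p.2)) (ν.prod volume) :=
    (halfPlaneMeasure_eq_prod ▸ h.meas₁).comp_measurePreserving hmp
  have hm₂ : AEStronglyMeasurable (fun p : ℝ × ℝ => g₂ (p.1, p.1 * v + p.2)) (ν.prod volume) :=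
    (halfPlaneMeasure_eq_prod ▸ h.meas₂).comp_measurePreserving hmp
  set g : ℝ × ℝ → ℝ := fun p => g₂ (p.1, p.1 * v + p.2) - v * g₁ (p.1, p.1 * v + p.2) with hg
  have hgm : AEStronglyMeasurable g (ν.prod volume) := hm₂.sub (hm₁.const_mul v)
  have hM₁ := hmp.quasiMeasurePreserving.ae hM₀
  set M := M₀ + |v| * M₀ with hM
  have hgM : ∀ᵐ p ∂(ν.prod volume), ‖g p‖ ≤ M := by
    filter_upwards [hM₁] with p hp
    refine (norm_sub_le _ _).trans (add_le_add hp.2 ?_)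
    rw [norm_mul]
    exact mul_le_mul_of_nonneg_left hp.1 (abs_nonneg v)
  -- The outer radius 1/2 < 1 makes both χ and χ' vanish for |z| ≥ 1.
  set bump : ContDiffBump (0 : ℝ) := ⟨1 / 4, 1 / 2, by norm_num, by norm_num⟩
  set χ : ℝ → ℝ := fun z => bump z with hχdef
  have hχ : ContDiff ℝ ∞ χ := bump.contDiff
  have hχc : HasCompactSupport χ := bump.hasCompactSupport
  have hχz : χ 0 = 1 := bump.one_of_mem_closedBall (by simp [bump])
  have hχ1 : ∀ z, 1 ≤ |z| → z ∉ tsupport χ := by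
    intro z hz
    rw [hχdef, bump.tsupport_eq, mem_closedBall_zero_iff, Real.norm_eq_abs, not_le]
    change (1 / 2 : ℝ) < _
    linarith
  have hχd : ∀ z, 1 ≤ |z| → deriv χ z = 0 := fun z hz => by
    by_contra hne
    exact hχ1 z hz (support_deriv_subset hne)
  have hχz1 : ∀ z, 1 ≤ |z| → χ z = 0 := fun z hz => image_eq_zero_of_notMem_tsupport (hχ1 z hz)
  have hχi : Integrable χ := hχ.continuous.integrable_of_hasCompactSupport hχc
  have hχ'c : Continuous (deriv χ) := hχ.continuous_deriv (by simp)
  have hχ'i : Integrable (deriv χ) := hχ'c.integrable_of_hasCompactSupport hχc.deriv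
  have hψi : Integrable ψ ν := hψ.continuous.integrable_of_hasCompactSupport hψc
  have hψ'i : Integrable (deriv ψ) ν :=
    (hψ.continuous_deriv (by simp)).integrable_of_hasCompactSupport hψc.deriv
  have hker : ∀ n : ℕ, 0 < n → Integrable (fun y : ℝ => n * deriv χ (n * y)) := fun n hn =>
    (hχ'i.comp_mul_left' (by exact_mod_cast hn.ne')).const_mul _
  have hi1 : ∀ n : ℕ, 0 < n → Integrable (fun p : ℝ × ℝ =>
      deriv ψ p.1 * χ (n * p.2) * g₁ (p.1, p.1 * v + p.2)) (ν.prod volume) := fun n hn =>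
    (hψ'i.mul_prod (hχi.comp_mul_left' (R := n) (by exact_mod_cast hn.ne'))).mul_bdd hm₁
      (hM₁.mono fun p hp => hp.1)
  have hi2 : ∀ n : ℕ, 0 < n → Integrable (fun p : ℝ × ℝ =>
      ψ p.1 * (n * deriv χ (n * p.2) * g p)) (ν.prod volume) := fun n hn => by
    have := (hψi.mul_prod (hker n hn)).mul_bdd hgm hgM
    simpa only [mul_assoc] using this
  set J : ℕ → ℝ → ℝ := fun n t => ∫ y : ℝ, n * deriv χ (n * y) * g (t, y) with hJ
  -- The term with ψ' lives on a strip of width O(1/n) and disappears in the limit; the term with χ'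
  -- produces the jump.
  have hmain : ∀ n : ℕ, 0 < n → 0 ≤ (∫ t, |deriv ψ t| ∂ν) * (∫ z, |χ z|) * M₀ / n
      + ∫ t, ψ t * J n t ∂ν := by
    intro n hn
    have hnpos : (0 : ℝ) < n := by exact_mod_cast hn
    have h1 := h.sheared_nonneg v hψ hψc hψ0 (hψT 0 (by simp)) hχ (fun z => bump.nonneg) hχz1
      hnpos
    rw [integral_add (hi1 n hn) (hi2 n hn), integral_prod _ (hi2 n hn)] at h1
    simp_rw [integral_const_mul] at h1
    refine h1.trans (add_le_add ?_ le_rfl)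
    have h2 : ‖∫ p : ℝ × ℝ, deriv ψ p.1 * χ (n * p.2) * g₁ (p.1, p.1 * v + p.2) ∂ν.prod volume‖
        ≤ ∫ p : ℝ × ℝ, |deriv ψ p.1| * |χ (n * p.2)| * M₀ ∂ν.prod volume := by
      refine norm_integral_le_of_norm_le ?_ ?_
      · exact (hψ'i.abs.mul_prod (hχi.abs.comp_mul_left' (R := n) hnpos.ne')).mul_const _
      · filter_upwards [hM₁] with p hp
        rw [norm_mul, norm_mul]
        exact mul_le_mul_of_nonneg_left hp.1 (by positivity)
    rw [integral_mul_const, integral_prod_mul (fun t => |deriv ψ t|) (fun y : ℝ => |χ (n * y)|),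
      Measure.integral_comp_mul_left (fun z => |χ z|), abs_inv, abs_of_pos hnpos,
      smul_eq_mul] at h2
    refine (le_abs_self _).trans (h2.trans (le_of_eq ?_))
    field_simp
  have hrest : ∀ F : ℝ → ℝ, ∫ t, ψ t * F t ∂ν = ∫ t in Ioc 0 T, ψ t * F t := by
    intro F
    refine (setIntegral_eq_of_subset_of_forall_sdiff_eq_zero measurableSet_Ioi
      (fun t ht => ht.1) fun t ht => ?_)
    rw [hψT t fun h' => ht.2 ⟨h'.1, h'.2.le⟩, zero_mul]
  have hle : volume.restrict (Ioc 0 T) ≤ ν := Measure.restrict_mono (fun t ht => ht.1) le_rfl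
  have hac := Measure.absolutelyContinuous_of_le hle
  have hsec : ∀ᵐ t ∂ν, AEStronglyMeasurable (fun y => g (t, y)) volume ∧
      ∀ᵐ y, |g (t, y)| ≤ M :=
    hgm.prodMk_left.and (Measure.ae_ae_of_ae_prod hgM)
  have hlim : Tendsto (fun n : ℕ => ∫ t in Ioc 0 T, ψ t * J n t) atTop
      (𝓝 (∫ t in Ioc 0 T, ψ t * (a t - b t))) := by
    -- The L¹ norm of n χ'(n y) does not depend on n ≥ 1, which yields a dominating function.
    have hA : ∀ n : ℕ, ∀ᵐ t ∂ν, ‖ψ t * J n t‖ ≤ |ψ t| * ((∫ z, |deriv χ z|) * M) := by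
      intro n
      filter_upwards [hsec] with t ht
      rw [norm_mul]
      refine mul_le_mul_of_nonneg_left ?_ (abs_nonneg _)
      have hM0 : 0 ≤ M := by
        obtain ⟨y, hy⟩ := ht.2.exists
        exact (abs_nonneg _).trans hy
      rcases Nat.eq_zero_or_pos n with rfl | hn
      · simp only [hJ, Nat.cast_zero, zero_mul, integral_zero, norm_zero]
        exact mul_nonneg (integral_nonneg fun z => abs_nonneg _) hM0
      have hnpos : (0 : ℝ) < n := by exact_mod_cast hn
      have h1 : ‖J n t‖ ≤ ∫ y : ℝ, |n * deriv χ (n * y)| * M :=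
        norm_integral_le_of_norm_le ((hker n hn).abs.mul_const _) (by
          filter_upwards [ht.2] with y hy
          rw [norm_mul]
          exact mul_le_mul_of_nonneg_left hy (norm_nonneg _))
      refine h1.trans (le_of_eq ?_)
      simp_rw [abs_mul, abs_of_pos hnpos]
      rw [integral_mul_const, integral_const_mul,
        Measure.integral_comp_mul_left (fun z => |deriv χ z|), abs_inv, abs_of_pos hnpos,
        smul_eq_mul, mul_inv_cancel_left₀ hnpos.ne']
    refine tendsto_integral_of_dominated_convergence
      (fun t => |ψ t| * ((∫ z, |deriv χ z|) * M)) (fun n => ?_) ?_ (fun n => hac.ae_le (hA n)) ?_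
    · refine AEStronglyMeasurable.mono_ac hac (hψ.continuous.aestronglyMeasurable.mul ?_)
      have : AEStronglyMeasurable (fun p : ℝ × ℝ => n * deriv χ (n * p.2) * g p)
          (ν.prod volume) :=
        AEStronglyMeasurable.mul (Continuous.aestronglyMeasurable (by fun_prop)) hgm
      exact this.integral_prod_right'
    · exact (hψi.abs.mul_const _).mono_measure hle
    · filter_upwards [ha, hb, hac.ae_le hsec] with t hta htb ht
      exact (tendsto_integral_deriv_bump (hχ.of_le (by simp)) hχc hχz hχd ht.1 ht.2 hta
        htb).const_mul _
  have hzero : Tendsto (fun n : ℕ => (∫ t, |deriv ψ t| ∂ν) * (∫ z, |χ z|) * M₀ / n) atTop (𝓝 0) :=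
    tendsto_const_div_atTop_nhds_zero_nat _
  have hsum := hzero.add hlim
  rw [zero_add] at hsum
  refine ge_of_tendsto hsum ?_
  filter_upwards [eventually_gt_atTop 0] with n hn
  rw [← hrest]
  exact hmain n hn

/-- The jump inequality along the line `x = t v`, integrated in time. -/
theorem IsWeakSupersolution.integral_jump_nonneg (h : IsWeakSupersolution g₁ g₂) (v : ℝ)
    {T : ℝ} (hT : 0 < T) {a b : ℝ → ℝ}
    (ha : ∀ᵐ t ∂(volume.restrict (Ioc 0 T)),
      EssTendstoAlong leftNhd (fun y => g₂ (t, t * v + y) - v * g₁ (t, t * v + y)) (a t))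
    (hb : ∀ᵐ t ∂(volume.restrict (Ioc 0 T)),
      EssTendstoAlong rightNhd (fun y => g₂ (t, t * v + y) - v * g₁ (t, t * v + y)) (b t))
    (hai : IntegrableOn a (Ioc 0 T)) (hbi : IntegrableOn b (Ioc 0 T)) :
    ∫ t in Ioc 0 T, b t ≤ ∫ t in Ioc 0 T, a t := by
  rw [← sub_nonneg, ← integral_sub hai hbi]
  -- These cutoffs live in (0,T) and increase to 1 there; the shift by 3 keeps the inner radius
  -- positive already at n = 0.
  set B : ℕ → ContDiffBump (T / 2) := fun n =>
    ⟨T / 2 * (1 - 2 / (n + 3)), T / 2 * (1 - 1 / (n + 3)), by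
      have : (2 : ℝ) / (n + 3) < 1 := by
        rw [div_lt_one (by positivity)]
        have : (0 : ℝ) ≤ n := n.cast_nonneg
        linarith
      have : (0 : ℝ) < 1 - 2 / (n + 3) := by linarith
      positivity, by
      refine mul_lt_mul_of_pos_left ?_ (by positivity)
      have : (1 : ℝ) / (n + 3) < 2 / (n + 3) := by gcongr; norm_num
      linarith⟩ with hB
  have hstep : ∀ n, 0 ≤ ∫ t in Ioc 0 T, B n t * (a t - b t) := by
    intro n
    refine h.integral_mul_jump_nonneg v ha hb (B n).contDiff (B n).hasCompactSupport
      (fun t => (B n).nonneg) fun t ht => (B n).zero_of_le_dist ?_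
    have h1 : (B n).rOut ≤ T / 2 := by
      have : (0 : ℝ) < 1 / (n + 3) := by positivity
      change T / 2 * (1 - 1 / (n + 3)) ≤ T / 2
      nlinarith
    refine h1.trans ?_
    rw [Real.dist_eq]
    by_contra hlt
    rw [not_le, abs_lt] at hlt
    exact ht ⟨by linarith [hlt.1], by linarith [hlt.2]⟩
  have hlim : Tendsto (fun n => ∫ t in Ioc 0 T, B n t * (a t - b t)) atTop
      (𝓝 (∫ t in Ioc 0 T, (a t - b t))) := by
    have hab : IntegrableOn (fun t => a t - b t) (Ioc 0 T) := hai.sub hbi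
    refine tendsto_integral_of_dominated_convergence (fun t => ‖a t - b t‖)
      (fun n => (B n).continuous.aestronglyMeasurable.mul hab.aestronglyMeasurable) hab.norm
      (fun n => Eventually.of_forall fun t => ?_) ?_
    · rw [norm_mul, Real.norm_eq_abs, abs_of_nonneg (B n).nonneg]
      exact mul_le_of_le_one_left (norm_nonneg _) (B n).le_one
    · rw [← restrict_Ioo_eq_restrict_Ioc]
      filter_upwards [ae_restrict_mem measurableSet_Ioo] with t ht
      have hev : ∀ᶠ n : ℕ in atTop, B n t = 1 := by
        have hr : Tendsto (fun n : ℕ => T / 2 * (1 - 2 / ((n : ℝ) + 3))) atTop (𝓝 (T / 2)) := by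
          have h1 : Tendsto (fun n : ℕ => (n : ℝ) + 3) atTop atTop :=
            tendsto_atTop_add_const_right _ _ tendsto_natCast_atTop_atTop
          simpa using ((h1.const_div_atTop 2).const_sub 1).const_mul (T / 2)
        have hd : |t - T / 2| < T / 2 := by
          rw [abs_lt]
          constructor <;> linarith [ht.1, ht.2]
        filter_upwards [hr.eventually_const_lt hd] with n hn
        refine (B n).one_of_mem_closedBall ?_
        rw [Metric.mem_closedBall, Real.dist_eq]
        exact hn.le
      refine tendsto_const_nhds.congr' ?_
      filter_upwards [hev] with n hn
      rw [hn, one_mul]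
  exact ge_of_tendsto' hlim hstep

end HalfPlane

/-! ### Entropy inequalities and traces of wild solutions. -/

section WildSolutions

variable {V₀ : Set StatePlane} {f : StatePlane → StatePlane} {η q : StatePlane → ℝ}
  {lam : Fin 2 → StatePlane → ℝ} {r : Fin 2 → StatePlane → StatePlane}

/-- A wild solution satisfies the weak inequality for the entropy `η - m`, with flux `q - m ∘ f`,
for every linear form `m`. -/
theorem IsWildSolution.isWeakSupersolution (h : IsAdmissibleSystem V₀ f η q lam r)
    {u : ℝ × ℝ → StatePlane} (hu : IsWildSolution V₀ f η q u) (m : StatePlane →L[ℝ] ℝ) :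
    IsWeakSupersolution (fun p => η (u p) - m (u p)) (fun p => q (u p) - m (f (u p))) := by
  obtain ⟨D, hD⟩ := h.bounded.exists_norm_le
  obtain ⟨M, hM⟩ := hu.nonlinear_bounded
  have huD : ∀ᵐ p ∂halfPlaneMeasure, ‖u p‖ ≤ D := hu.mem.mono fun p hp => hD _ hp
  have mf := h.flux_cont.comp_aestronglyMeasurable_of_ae_mem hu.meas hu.mem
  have mη := h.entropy_cont.comp_aestronglyMeasurable_of_ae_mem hu.meas hu.mem
  have mq := h.entropyFlux_cont.comp_aestronglyMeasurable_of_ae_mem hu.meas hu.mem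
  refine ⟨mη.sub (m.continuous.comp_aestronglyMeasurable hu.meas),
    mq.sub (m.continuous.comp_aestronglyMeasurable mf),
    ⟨M + ‖m‖ * max D M, ?_⟩, fun φ hφ hφc hφ0 hφz => ?_⟩
  · have hm : ∀ x : StatePlane, ‖x‖ ≤ max D M → |m x| ≤ ‖m‖ * max D M := fun x hx =>
      (m.le_opNorm x).trans (mul_le_mul_of_nonneg_left hx (norm_nonneg _))
    filter_upwards [huD, hM] with p hp hpM
    exact ⟨(abs_sub _ _).trans (add_le_add hpM.2.1 (hm _ (hp.trans (le_max_left _ _)))),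
      (abs_sub _ _).trans (add_le_add hpM.2.2 (hm _ (hpM.1.trans (le_max_right _ _))))⟩
  · obtain ⟨u0, -, -, -, hw, he⟩ := hu.weak
    have hcd : ∀ e : ℝ × ℝ, Continuous fun p => fderiv ℝ φ p e := fun e =>
      (hφ.continuous_fderiv (by simp)).clm_apply continuous_const
    have hint : ∀ e : ℝ × ℝ, Integrable (fun p => fderiv ℝ φ p e) halfPlaneMeasure := fun e => by
      have : IsFiniteMeasureOnCompacts halfPlaneMeasure := by
        rw [halfPlaneMeasure]
        infer_instance
      exact (hcd e).integrable_of_hasCompactSupport (hφc.fderiv_apply ℝ e)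
    have i1 : Integrable (fun p => fderiv ℝ φ p (1, 0) • u p + fderiv ℝ φ p (0, 1) • f (u p))
        halfPlaneMeasure :=
      ((hint _).smul_bdd D hu.meas huD).add ((hint _).smul_bdd M mf (hM.mono fun p hp => hp.1))
    have i2 : Integrable (fun p => fderiv ℝ φ p (1, 0) * η (u p) + fderiv ℝ φ p (0, 1) * q (u p))
        halfPlaneMeasure :=
      ((hint _).mul_bdd mη (hM.mono fun p hp => hp.2.1)).add
        ((hint _).mul_bdd mq (hM.mono fun p hp => hp.2.2))
    have hw' := hw φ hφ hφc
    have he' := he φ hφ hφc fun t x _ => hφ0 _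
    simp only [hφz, zero_smul, zero_mul, integral_zero, add_zero] at hw' he'
    -- The conservation law holds with equality, so applying m to it and subtracting leaves the
    -- entropy inequality intact. The initial terms are gone because φ vanishes at t = 0.
    have hmw := m.integral_comp_comm i1
    rw [hw', map_zero] at hmw
    have hsub := integral_sub i2 (m.integrable_comp i1)
    rw [hmw, sub_zero] at hsub
    rw [← hsub] at he'
    refine he'.trans_eq (integral_congr_ae (Eventually.of_forall fun p => ?_))
    simp only [map_add, map_smul, smul_eq_mul]
    ring

/-- Strong traces on the sides `I n` of a curve are limits along `I n` at almost every time. -/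
theorem ae_tendsto_essSup_of_trace {u : ℝ × ℝ → StatePlane}
    (hu : AEStronglyMeasurable u halfPlaneMeasure) (v : ℝ) {I : ℕ → Set ℝ}
    (hI : Antitone fun n => I (n + 1)) {w : ℝ → StatePlane}
    (hw : AEStronglyMeasurable w (volume.restrict (Ioi 0))) {T : ℝ}
    (hlim : Tendsto (fun n : ℕ => ∫⁻ t in Ioc 0 T,
      essSup (fun y => ‖u (t, t * v + y) - w t‖ₑ) (volume.restrict (I n))) atTop (𝓝 0)) :
    ∀ᵐ t ∂(volume.restrict (Ioc 0 T)), Tendsto (fun n =>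
      essSup (fun y => ‖u (t, t * v + y) - w t‖ₑ) (volume.restrict (I n))) atTop (𝓝 0) := by
  refine ae_tendsto_zero_of_antitone_of_lintegral (fun n => ?_) (fun t n k hnk => ?_) hlim
  · have hle : volume.restrict (Ioc 0 T) ≤ volume.restrict (Ioi (0 : ℝ)) :=
      Measure.restrict_mono (fun t ht => ht.1) le_rfl
    have hac := Measure.absolutelyContinuous_of_le hle
    have hmp := measurePreserving_shear (volume.restrict (Ioi (0 : ℝ))) v
    have h1 : AEStronglyMeasurable (fun p : ℝ × ℝ => u (p.1, p.1 * v + p.2))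
        ((volume.restrict (Ioi (0 : ℝ))).prod volume) :=
      (halfPlaneMeasure_eq_prod ▸ hu).comp_measurePreserving hmp
    have h2 := (h1.sub hw.comp_fst).mono_ac
      (hac.prod (Measure.absolutelyContinuous_of_le (Measure.restrict_le_self (s := I n))))
    exact h2.enorm.essSup_prodMk_left
  · exact essSup_mono_measure (Measure.absolutelyContinuous_of_le
      (Measure.restrict_mono (hI hnk) le_rfl))

theorem antitone_rightNhd : Antitone fun n => rightNhd (n + 1) := by
  intro n k hnk
  refine Ioo_subset_Ioo le_rfl ?_
  push_cast
  gcongr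

theorem antitone_leftNhd : Antitone fun n => leftNhd (n + 1) := by
  intro n k hnk
  refine Ioo_subset_Ioo (neg_le_neg ?_) le_rfl
  push_cast
  gcongr

/-- The limits of nonlinear functions of `u` along one side of the line `x = t v`. -/
theorem ae_essTendstoAlong_of_trace {u : ℝ × ℝ → StatePlane}
    (hu : AEStronglyMeasurable u halfPlaneMeasure) (hmem : ∀ᵐ p ∂halfPlaneMeasure, u p ∈ V₀)
    (v : ℝ) {I : ℕ → Set ℝ} (hI : Antitone fun n => I (n + 1)) {w : ℝ → StatePlane}
    (hw : AEStronglyMeasurable w (volume.restrict (Ioi 0)))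
    (hwV : ∀ᵐ t ∂(volume.restrict (Ioi (0 : ℝ))), w t ∈ V₀) {T : ℝ}
    (hlim : Tendsto (fun n : ℕ => ∫⁻ t in Ioc 0 T,
      essSup (fun y => ‖u (t, t * v + y) - w t‖ₑ) (volume.restrict (I n))) atTop (𝓝 0))
    {g : StatePlane → ℝ} (hg : ContinuousOn g V₀) :
    ∀ᵐ t ∂(volume.restrict (Ioc 0 T)),
      EssTendstoAlong I (fun y => g (u (t, t * v + y))) (g (w t)) := by
  have hac := Measure.absolutelyContinuous_of_le
    (Measure.restrict_mono (μ := (volume : Measure ℝ)) (s := Ioc 0 T) (s' := Ioi 0)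
      (fun t ht => ht.1) le_rfl)
  have hmem' : ∀ᵐ t ∂(volume.restrict (Ioi (0 : ℝ))), ∀ᵐ y, u (t, t * v + y) ∈ V₀ :=
    Measure.ae_ae_of_ae_prod ((measurePreserving_shear _ v).quasiMeasurePreserving.ae
      (halfPlaneMeasure_eq_prod ▸ hmem))
  filter_upwards [ae_tendsto_essSup_of_trace hu v hI hw hlim, hac.ae_le hwV, hac.ae_le hmem']
    with t ht htV htm
  exact EssTendstoAlong.of_essSup ht htm (hg _ htV)

/-- Bounded functions of the solution have bounded, hence integrable, traces. -/
theorem integrableOn_trace {u : ℝ × ℝ → StatePlane} (v : ℝ) {I : ℕ → Set ℝ}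
    (hIv : ∀ᶠ n in atTop, volume (I n) ≠ 0) {w : ℝ → StatePlane}
    (hw : AEStronglyMeasurable w (volume.restrict (Ioi 0)))
    (hwV : ∀ᵐ t ∂(volume.restrict (Ioi (0 : ℝ))), w t ∈ V₀) {T : ℝ}
    {g : StatePlane → ℝ} (hg : ContinuousOn g V₀)
    (hlim : ∀ᵐ t ∂(volume.restrict (Ioc 0 T)),
      EssTendstoAlong I (fun y => g (u (t, t * v + y))) (g (w t)))
    {M : ℝ} (hM : ∀ᵐ p ∂halfPlaneMeasure, |g (u p)| ≤ M) :
    IntegrableOn (fun t => g (w t)) (Ioc 0 T) := by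
  have hac := Measure.absolutelyContinuous_of_le
    (Measure.restrict_mono (μ := (volume : Measure ℝ)) (s := Ioc 0 T) (s' := Ioi 0)
      (fun t ht => ht.1) le_rfl)
  have hM' : ∀ᵐ t ∂(volume.restrict (Ioi (0 : ℝ))), ∀ᵐ y, |g (u (t, t * v + y))| ≤ M :=
    Measure.ae_ae_of_ae_prod ((measurePreserving_shear _ v).quasiMeasurePreserving.ae
      (halfPlaneMeasure_eq_prod ▸ hM))
  have hm : AEStronglyMeasurable (fun t => g (w t)) (volume.restrict (Ioc 0 T)) :=
    (hg.comp_aestronglyMeasurable_of_ae_mem hw hwV).mono_ac hac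
  refine Integrable.of_bound hm M ?_
  filter_upwards [hlim, hac.ae_le hM'] with t ht htM
  exact ht.abs_le hIv htM

end WildSolutions

/-! ### Conclusion. -/

theorem rarefactionSize_ge (vL vR : ℝ) (ubar : ℝ → StatePlane) :
    vR - vL ≤ rarefactionSize vL vR ubar := by
  -- Only the speed part of δ is used; a real `sSup` of nonnegative numbers is nonnegative even for
  -- an unbounded set.
  have h1 : 0 ≤ sSup ((fun y => ‖ubar vL - ubar y‖) '' Icc vL vR) := by
    refine Real.sSup_nonneg ?_
    rintro _ ⟨y, -, rfl⟩
    exact norm_nonneg _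
  have h2 := neg_abs_le (vL - vR)
  rw [rarefactionSize]
  linarith

theorem proposition4p3 (V₀ : Set StatePlane) (f : StatePlane → StatePlane)
    (η q : StatePlane → ℝ) (lam : Fin 2 → StatePlane → ℝ) (r : Fin 2 → StatePlane → StatePlane)
    (hsys : IsAdmissibleSystem V₀ f η q lam r)
    (K : Set StatePlane) (hK : IsCompact K) (hKV : K ⊆ interior V₀) :
    ∃ C : ℝ, 0 < C ∧
      ∀ (vL vR : ℝ) (ubar : ℝ → StatePlane), IsRarefactionWave V₀ f lam vL vR ubar →
        (∀ y ∈ Icc vL vR, ubar y ∈ K) →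
        ∀ u : ℝ × ℝ → StatePlane, IsWildSolution V₀ f η q u →
        ∀ v ∈ Icc vL vR,
        ∀ uminus uplus : ℝ → StatePlane, HasStrongTraces u (fun s => s * v) uminus uplus →
          (∀ᵐ s ∂(volume.restrict (Ioi (0 : ℝ))), uminus s ∈ V₀ ∧ uplus s ∈ V₀) →
        ∀ t : ℝ, 0 < t →
          IntervalIntegrable (fun s =>
            relEntropyFlux f η q (uplus s) (ubar vR) - relEntropyFlux f η q (uminus s) (ubar vL)
              - v * (relEntropy η (uplus s) (ubar vR) - relEntropy η (uminus s) (ubar vL)))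
            volume 0 t ∧
          ∫ s in (0 : ℝ)..t,
            (relEntropyFlux f η q (uplus s) (ubar vR) - relEntropyFlux f η q (uminus s) (ubar vL)
              - v * (relEntropy η (uplus s) (ubar vR) - relEntropy η (uminus s) (ubar vL)))
            ≤ C * rarefactionSize vL vR ubar * ‖ubar vL - ubar vR‖ * t := by
  obtain ⟨C, hC, hCle⟩ := hsys.exists_relative_sub_le hK hKV
  refine ⟨C, hC, fun vL vR ubar hwave hubar u hu v hv uminus uplus htr hmem t ht => ?_⟩
  -- The relative quantities as functions of the first variable.
  set G : StatePlane → StatePlane → ℝ := fun b a =>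
    relEntropyFlux f η q a b - v * relEntropy η a b with hG
  have hGc : ∀ b, ContinuousOn (G b) V₀ := fun b =>
    ((hsys.entropyFlux_cont.sub continuousOn_const).sub
      ((fderiv ℝ η b).continuous.comp_continuousOn (hsys.flux_cont.sub continuousOn_const))).sub
    (continuousOn_const.mul ((hsys.entropy_cont.sub continuousOn_const).sub
      ((fderiv ℝ η b).continuous.comp_continuousOn (continuousOn_id.sub continuousOn_const))))
  -- With m = η'(b), the flux of η - m minus v times η - m is G b up to a constant, which cancels in
  -- the jump.
  have hGex : ∀ b, ∃ c, ∀ a, q a - fderiv ℝ η b (f a) - v * (η a - fderiv ℝ η b a)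
      = G b a + c := fun b =>
    ⟨q b - fderiv ℝ η b (f b) - v * (η b - fderiv ℝ η b b), fun a => by
      simp only [hG, relEntropyFlux, relEntropy, map_sub]
      ring⟩
  choose c hGsplit using hGex
  have hminus : ∀ᵐ s ∂(volume.restrict (Ioi (0 : ℝ))), uminus s ∈ V₀ := hmem.mono fun s hs => hs.1
  have hplus : ∀ᵐ s ∂(volume.restrict (Ioi (0 : ℝ))), uplus s ∈ V₀ := hmem.mono fun s hs => hs.2
  have hbdd : ∀ b, ∃ M, ∀ᵐ p ∂halfPlaneMeasure, |G b (u p)| ≤ M := fun b => by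
    obtain ⟨M, hM⟩ := (hu.isWeakSupersolution hsys (fderiv ℝ η b)).bounded
    refine ⟨M + |v| * M + |c b|, ?_⟩
    filter_upwards [hM] with p hp
    rw [eq_sub_of_add_eq (hGsplit b (u p)).symm]
    refine (abs_sub _ _).trans (add_le_add ((abs_sub _ _).trans (add_le_add hp.2 ?_)) le_rfl)
    rw [abs_mul]
    exact mul_le_mul_of_nonneg_left hp.1 (abs_nonneg v)
  have hlimp : ∀ {g : StatePlane → ℝ}, ContinuousOn g V₀ →
      ∀ᵐ s ∂(volume.restrict (Ioc 0 t)),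
        EssTendstoAlong rightNhd (fun y => g (u (s, s * v + y))) (g (uplus s)) := fun hg =>
    ae_essTendstoAlong_of_trace hu.meas hu.mem v antitone_rightNhd htr.meas_plus hplus
      (htr.lim_plus t ht) hg
  have hlimm : ∀ {g : StatePlane → ℝ}, ContinuousOn g V₀ →
      ∀ᵐ s ∂(volume.restrict (Ioc 0 t)),
        EssTendstoAlong leftNhd (fun y => g (u (s, s * v + y))) (g (uminus s)) := fun hg =>
    ae_essTendstoAlong_of_trace hu.meas hu.mem v antitone_leftNhd htr.meas_minus hminus
      (htr.lim_minus t ht) hg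
  have hintp : ∀ b, IntegrableOn (fun s => G b (uplus s)) (Ioc 0 t) := fun b => by
    obtain ⟨M, hM⟩ := hbdd b
    exact integrableOn_trace v volume_rightNhd_ne_zero htr.meas_plus hplus (hGc b)
      (hlimp (hGc b)) hM
  have hintm : ∀ b, IntegrableOn (fun s => G b (uminus s)) (Ioc 0 t) := fun b => by
    obtain ⟨M, hM⟩ := hbdd b
    exact integrableOn_trace v volume_leftNhd_ne_zero htr.meas_minus hminus (hGc b)
      (hlimm (hGc b)) hM
  -- The line is crossed with the reference state u_R frozen; u_R is exchanged for u_L afterwards,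
  -- at the left trace.
  have hjump : ∫ s in Ioc 0 t, G (ubar vR) (uplus s) ≤ ∫ s in Ioc 0 t, G (ubar vR) (uminus s) := by
    set d := c (ubar vR)
    have hGc' : ContinuousOn (fun a => G (ubar vR) a + d) V₀ := (hGc _).add continuousOn_const
    have h1 := (hu.isWeakSupersolution hsys (fderiv ℝ η (ubar vR))).integral_jump_nonneg v ht
      (a := fun s => G (ubar vR) (uminus s) + d) (b := fun s => G (ubar vR) (uplus s) + d)
      (by simpa only [hGsplit] using hlimm hGc') (by simpa only [hGsplit] using hlimp hGc')
      ((hintm _).add (integrable_const d)) ((hintp _).add (integrable_const d))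
    rw [integral_add (hintm _) (integrable_const d), integral_add (hintp _) (integrable_const d)]
      at h1
    linarith
  have heq : (fun s => relEntropyFlux f η q (uplus s) (ubar vR)
      - relEntropyFlux f η q (uminus s) (ubar vL)
      - v * (relEntropy η (uplus s) (ubar vR) - relEntropy η (uminus s) (ubar vL)))
      = fun s => G (ubar vR) (uplus s) - G (ubar vL) (uminus s) := by
    funext s
    simp only [hG]
    ring
  rw [heq, intervalIntegrable_iff_integrableOn_Ioc_of_le ht.le,
    intervalIntegral.integral_of_le ht.le]
  refine ⟨(hintp _).sub (hintm _), ?_⟩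
  have hac := Measure.absolutelyContinuous_of_le
    (Measure.restrict_mono (μ := (volume : Measure ℝ)) (s := Ioc 0 t) (s' := Ioi 0)
      (fun t ht => ht.1) le_rfl)
  have hstates : ∫ s in Ioc 0 t, (G (ubar vR) (uminus s) - G (ubar vL) (uminus s))
      ≤ ∫ s in Ioc 0 t, C * (vR - vL) * ‖ubar vL - ubar vR‖ := by
    refine integral_mono_ae ((hintm _).sub (hintm _)) (integrable_const _) ?_
    filter_upwards [hac.ae_le hminus] with s hs
    exact hCle vL vR ubar hwave hubar v hv _ hs
  rw [integral_sub (hintm _) (hintm _)] at hstates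
  rw [integral_sub (hintp _) (hintm _)]
  have hsize : ∫ s in Ioc 0 t, C * (vR - vL) * ‖ubar vL - ubar vR‖
      ≤ C * rarefactionSize vL vR ubar * ‖ubar vL - ubar vR‖ * t := by
    rw [setIntegral_const, smul_eq_mul, mul_comm _ t]
    simp only [measureReal_def, Real.volume_Ioc, sub_zero, ENNReal.toReal_ofReal ht.le]
    have := rarefactionSize_ge vL vR ubar
    gcongr
  linarith
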